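/- Let $d\ge 3$ be odd and let $\mathcal M_d$ denote the complex $d\times d$ matrices. A linear map $T:\mathcal M_d\to\mathcal M_d$ is a mixture of unitary channels if $T(\rho)=\sum_{i=1}^N p_i U_i\rho U_i^\dagger$ with $p_i>0$, $\sum_i p_i=1$ and $U_i$ unitary; it is $O(d)$-covariant if $T(O\rho O^{T})=O\,T(\rho)\,O^{T}$ for all real orthogonal $O$ and all $\rho$. Put $|\Omega\rangle=d^{-1/2}\sum_{j}|j,j\rangle$, $\rho_T=(\mathrm{id}\otimes T)(|\Omega\rangle\langle\Omega|)$, let $\mathbb F:|k,l\rangle\mapsto|l,k\rangle$ be the flip and $\widehat{\mathbb F}=d\,|\Omega\rangle\langle\Omega|$, and define the coordinates $$c(T)=\big(\langle\mathbb F\rangle_T,\langle\widehat{\mathbb F}\rangle_T\big)=\big(\mathrm{Re}\,\mathrm{tr}[\rho_T\mathbb F],\ \mathrm{Re}\,\mathrm{tr}[\rho_T\widehat{\mathbb F}]\big)$$ (the traces are themselves real for channels). Let $$m(x)=\Big[\tfrac12\big(1-\tfrac1d\big)\big(1-\tfrac2d+x\big)\Big]^{1/2}+\tfrac1d .$$ **Theorem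 (Odd dimension).** An $O(d)$-covariant mixture $T$ of unitary channels is determined by $c(T)$. The set of coordinates of all $O(d)$-covariant mixtures of unitary channels coincides with the set of coordinates of all mixtures of unitary channels, and with the convex hull of the coordinates of the unitary channels $\rho\mapsto U\rho U^\dagger$, $U\in U(d)$. The extreme points of this set are exactly $$\big(-1+\tfrac2d,\,0\big),\qquad (1,0)\qquad\text{and}\qquad \big(x,\ d\,m(x)^2\big),\quad x\in\big[-1+\tfrac2d,\,1\big].$$ In particular, no linear map $T$ on $\mathcal M_d$ with $\langle\mathbb F\rangle_T<-1+\frac2d$ is a mixture of unitary channels. For the Werner–Holevo-type maps $T_\delta(\rho)=\frac{1+\delta}{d}\,\mathrm{tr}[\rho]\,\mathbb 1-\delta\,\rho^{T}$, $\delta\in\mathbb R$, one has $\langle\mathbb F\rangle_{T_\delta}<-1+\frac2d$ if and only if $\delta>\frac1{d+1}$, so that $T_\delta$ is not a mixture of unitary channels for $\delta>\frac1{d+1}$. -/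

import Mathlib

open Matrix

namespace Birkhoff

noncomputable section

/-- The `d × d` complex matrices. -/
abbrev Mat (d : ℕ) : Type := Matrix (Fin d) (Fin d) ℂ

/-- Matrices on the tensor product of two copies of `ℂ^d`. -/
abbrev BiMat (d : ℕ) : Type := Matrix (Fin d × Fin d) (Fin d × Fin d) ℂ

/-- The maximally entangled vector `Ω = d^(-1/2) ∑ j, |j,j⟩`. -/
def omegaVec (d : ℕ) : Fin d × Fin d → ℂ :=
  fun p => if p.1 = p.2 then ((1 / Real.sqrt d : ℝ) : ℂ) else 0

/-- The projector `|Ω⟩⟨Ω|`. -/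
def omegaProj (d : ℕ) : BiMat d :=
  vecMulVec (omegaVec d) (star (omegaVec d))

/-- The map `id ⊗ T` on bipartite matrices: `T` is applied to each `d × d` block. -/
def idTensor {d : ℕ} (T : Mat d →ₗ[ℂ] Mat d) (X : BiMat d) : BiMat d :=
  Matrix.of fun p q => T (Matrix.of fun a b => X (p.1, a) (q.1, b)) p.2 q.2

/-- The Jamiolkowski operator `ρ_T = (id ⊗ T)(|Ω⟩⟨Ω|)`. -/
def jamiolkowski {d : ℕ} (T : Mat d →ₗ[ℂ] Mat d) : BiMat d :=
  idTensor T (omegaProj d)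

/-- The flip operator `|k,l⟩ ↦ |l,k⟩`. -/
def flip (d : ℕ) : BiMat d :=
  Matrix.of fun p q => if p.1 = q.2 ∧ p.2 = q.1 then 1 else 0

/-- The operator `d |Ω⟩⟨Ω|`. -/
def flipHat (d : ℕ) : BiMat d := (d : ℂ) • omegaProj d

/-- The coordinates `(tr[ρ_T F], tr[ρ_T F̂])`. Both traces are real whenever `ρ_T` is Hermitian,
in particular for every channel. -/
def coords {d : ℕ} (T : Mat d →ₗ[ℂ] Mat d) : ℝ × ℝ :=
  ((jamiolkowski T * flip d).trace.re, (jamiolkowski T * flipHat d).trace.re)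

/-- The unitary channel `ρ ↦ U ρ U†`. -/
def unitaryChannel {d : ℕ} (U : Matrix.unitaryGroup (Fin d) ℂ) : Mat d →ₗ[ℂ] Mat d where
  toFun ρ := (U : Mat d) * ρ * (U : Mat d)ᴴ
  map_add' ρ τ := by rw [Matrix.mul_add, Matrix.add_mul]
  map_smul' c ρ := by rw [Matrix.mul_smul, Matrix.smul_mul, RingHom.id_apply]

/-- `T` is a mixture of unitary channels, `T(ρ) = ∑ i, p i • U i ρ (U i)†` with probabilities
`p i > 0`. -/
def IsUnitaryMixture {d : ℕ} (T : Mat d →ₗ[ℂ] Mat d) : Prop :=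
  ∃ (N : ℕ) (p : Fin N → ℝ) (U : Fin N → Matrix.unitaryGroup (Fin d) ℂ),
    (∀ i, 0 < p i) ∧ ∑ i, p i = 1 ∧ ∀ ρ, T ρ = ∑ i, (p i : ℂ) • unitaryChannel (U i) ρ

/-- `O(d)`-covariance: `T(O ρ Oᵀ) = O T(ρ) Oᵀ` for every real orthogonal `O`. -/
def IsOrthogonalCovariant {d : ℕ} (T : Mat d →ₗ[ℂ] Mat d) : Prop :=
  ∀ O ∈ Matrix.orthogonalGroup (Fin d) ℝ, ∀ ρ : Mat d,
    T (O.map Complex.ofReal * ρ * (O.map Complex.ofReal)ᵀ) =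
      O.map Complex.ofReal * T ρ * (O.map Complex.ofReal)ᵀ

/-- The mixtures of unitary channels on `d × d` matrices. -/
def unitaryMixtures (d : ℕ) : Set (Mat d →ₗ[ℂ] Mat d) := {T | IsUnitaryMixture T}

/-- The `O(d)`-covariant mixtures of unitary channels. -/
def covariantUnitaryMixtures (d : ℕ) : Set (Mat d →ₗ[ℂ] Mat d) :=
  {T | IsUnitaryMixture T ∧ IsOrthogonalCovariant T}

/-- `m(x) = [(1/2) (1 - 1/d) (1 - 2/d + x)]^(1/2) + 1/d`. -/
def maxTrace (d : ℕ) (x : ℝ) : ℝ :=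
  Real.sqrt (1 / 2 * (1 - 1 / d) * (1 - 2 / d + x)) + 1 / d

/-- The Werner-Holevo type map `ρ ↦ ((1 + δ) / d) tr[ρ] 1 - δ ρᵀ`; for `δ = 1 / (d - 1)` it is the
Werner-Holevo channel `ρ ↦ (tr[ρ] 1 - ρᵀ) / (d - 1)`. -/
def wernerHolevo (d : ℕ) (δ : ℝ) : Mat d →ₗ[ℂ] Mat d where
  toFun ρ := (((1 + δ) / d : ℝ) : ℂ) • (ρ.trace • (1 : Mat d)) - (δ : ℂ) • ρᵀ
  map_add' ρ τ := by
    rw [Matrix.trace_add, Matrix.transpose_add, add_smul, smul_add, smul_add]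
    abel
  map_smul' c ρ := by
    ext i j
    simp only [Matrix.trace_smul, Matrix.transpose_smul, RingHom.id_apply, Matrix.sub_apply,
      Matrix.smul_apply, smul_eq_mul]
    ring

end

end Birkhoff

/-! Both coordinates are real-linear in the map, and mixtures form the convex hull of the unitary
channels, so the planar set to determine is the hull of the points (tr(U Ū)/d, |tr U|²/d). Its upper
boundary comes from one fact about odd size: U - Uᵀ is antisymmetric, hence singular, so some unit
vector v satisfies Uv = Uᵀv = w. The symmetric part S of U then sends v to the unit vector w.
Splitting off w v† leaves a remainder R with R v = 0 and ‖R‖² = ‖S‖² - 1, and Cauchy–Schwarz gives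
|tr U| ≤ 1 + √((d-1)(‖S‖² - 1)) (`symNormSq_bounds`). Since ‖S‖² = (d + tr(U Ū))/2, this places
every unitary channel in `region d`.

Conversely, block rotations trace the curve, a diagonal matrix of roots of unity gives (1, 0), and a
congruence W V Wᵀ of a block rotation gives the other corner. The curve is strictly concave, so the
region is convex, equals the hull (`convexHull_coords_eq_region`), and has the stated extreme points
(`extremePoints_region`).

Passing to covariant mixtures loses no coordinates: among the mixtures with prescribed coordinates,
the one whose Jamiolkowski operator has least Frobenius norm is unique, and conjugation by real
orthogonal matrices preserves both the norm and the coordinates, so this minimizer is covariant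
(`coords_image_covariantUnitaryMixtures`). A covariant map is a combination of tr(·)1, the identity
and the transpose (`apply_single`); trace preservation and the two coordinates fix the three
coefficients. -/

namespace Birkhoff

/-! ### Linearity of the coordinates and mixtures as a convex hull -/

/-- The Jamiolkowski operator as a real-linear function of the map. -/
noncomputable def jamiolkowskiLin (d : ℕ) : (Mat d →ₗ[ℂ] Mat d) →ₗ[ℝ] BiMat d where
  toFun T := jamiolkowski T
  map_add' T S := by
    ext p q
    simp [jamiolkowski, idTensor]
  map_smul' c T := by
    ext p q
    simp [jamiolkowski, idTensor]

/-- The two traces defining `coords`, as a real-linear function of the Jamiolkowski operator. -/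
noncomputable def flipTraces (d : ℕ) : BiMat d →ₗ[ℝ] ℝ × ℝ where
  toFun X := ((X * flip d).trace.re, (X * flipHat d).trace.re)
  map_add' X Y := by simp [Matrix.add_mul]
  map_smul' c X := by simp

/-- `coords` as a real-linear map. -/
noncomputable def coordsLin (d : ℕ) : (Mat d →ₗ[ℂ] Mat d) →ₗ[ℝ] ℝ × ℝ :=
  flipTraces d ∘ₗ jamiolkowskiLin d

lemma coordsLin_apply {d : ℕ} (T : Mat d →ₗ[ℂ] Mat d) : coordsLin d T = coords T := rfl

lemma omegaProj_apply {d : ℕ} (p q : Fin d × Fin d) :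
    omegaProj d p q = if p.1 = p.2 ∧ q.1 = q.2 then (1 / d : ℂ) else 0 := by
  have h : ((Real.sqrt d : ℝ) : ℂ) * ((Real.sqrt d : ℝ) : ℂ) = d := by
    rw [← Complex.ofReal_mul, Real.mul_self_sqrt (Nat.cast_nonneg d), Complex.ofReal_natCast]
  have h' : ((Real.sqrt d : ℝ) : ℂ)⁻¹ * ((Real.sqrt d : ℝ) : ℂ)⁻¹ = (d : ℂ)⁻¹ := by
    rw [← mul_inv, h]
  by_cases h1 : p.1 = p.2 <;> by_cases h2 : q.1 = q.2 <;>
    simp [omegaProj, omegaVec, vecMulVec_apply, h1, h2, h']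

lemma jamiolkowski_apply {d : ℕ} (T : Mat d →ₗ[ℂ] Mat d) (p q : Fin d × Fin d) :
    jamiolkowski T p q = 1 / d * T (Matrix.single p.1 q.1 1) p.2 q.2 := by
  have : (Matrix.of fun a b => omegaProj d (p.1, a) (q.1, b)) =
      (1 / d : ℂ) • Matrix.single p.1 q.1 (1 : ℂ) := by
    ext a b
    simp [omegaProj_apply, Matrix.single_apply]
  simp only [jamiolkowski, idTensor, this, map_smul, Matrix.of_apply, Matrix.smul_apply,
    smul_eq_mul]

/-- Matrix units span, and their images are the blocks of the operator up to 1/d. This transfers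
uniqueness of operators back to maps. -/
lemma jamiolkowskiLin_injective {d : ℕ} (hd : d ≠ 0) :
    Function.Injective (jamiolkowskiLin d) := by
  intro T S h
  have hd' : (d : ℂ) ≠ 0 := by exact_mod_cast hd
  have key : ∀ i j, T (Matrix.single i j 1) = S (Matrix.single i j 1) := by
    intro i j
    ext a b
    have := congrFun (congrFun h (i, a)) (j, b)
    change jamiolkowski T _ _ = jamiolkowski S _ _ at this
    rw [jamiolkowski_apply, jamiolkowski_apply] at this
    exact mul_left_cancel₀ (by simpa using hd') this
  refine LinearMap.ext fun ρ => ?_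
  rw [Matrix.matrix_eq_sum_single ρ]
  simp only [map_sum]
  refine Finset.sum_congr rfl fun i _ => Finset.sum_congr rfl fun j _ => ?_
  have : Matrix.single i j (ρ i j) = ρ i j • Matrix.single i j (1 : ℂ) := by simp
  rw [this, map_smul, map_smul, key]

lemma coords_eq_sum {d : ℕ} (T : Mat d →ₗ[ℂ] Mat d) :
    coords T = ((1 / d * ∑ i, ∑ a, T (Matrix.single i a 1) a i : ℂ).re,
      (1 / d * ∑ i, ∑ j, T (Matrix.single i j 1) i j : ℂ).re) := by
  rcases eq_or_ne d 0 with rfl | hd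
  · simp [coords, Matrix.trace]
  have hd' : (d : ℂ) ≠ 0 := by exact_mod_cast hd
  have h1 : (jamiolkowski T * flip d).trace =
      1 / d * ∑ i, ∑ a, T (Matrix.single i a 1) a i := by
    simp only [Matrix.trace, Matrix.diag_apply, Matrix.mul_apply, Fintype.sum_prod_type,
      jamiolkowski_apply, flip, Matrix.of_apply, Finset.mul_sum, ite_and, mul_ite, mul_one, mul_zero]
    simp [Finset.sum_ite_irrel]
  have h2 : (jamiolkowski T * flipHat d).trace =
      1 / d * ∑ i, ∑ j, T (Matrix.single i j 1) i j := by
    simp only [Matrix.trace, Matrix.diag_apply, Matrix.mul_apply, Fintype.sum_prod_type,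
      jamiolkowski_apply, flipHat, Matrix.smul_apply, omegaProj_apply, smul_eq_mul,
      Finset.mul_sum, ite_and, mul_ite, mul_zero]
    simp [mul_inv_cancel₀ hd', Finset.sum_ite_eq]
  rw [coords, h1, h2]

lemma unitaryChannel_apply {d : ℕ} (U : Matrix.unitaryGroup (Fin d) ℂ) (ρ : Mat d) :
    unitaryChannel U ρ = (U : Mat d) * ρ * (U : Mat d)ᴴ := rfl

lemma unitaryChannel_single {d : ℕ} (U : Matrix.unitaryGroup (Fin d) ℂ) (i j a b : Fin d) :
    unitaryChannel U (Matrix.single i j 1) a b = (U : Mat d) a i * star ((U : Mat d) b j) := by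
  rw [unitaryChannel_apply, Matrix.mul_assoc, Matrix.mul_apply, Finset.sum_eq_single i]
  · rw [Matrix.single_mul_apply_same, one_mul, Matrix.conjTranspose_apply]
  · intro k _ hk
    rw [Matrix.single_mul_apply_of_ne _ _ _ _ _ hk, mul_zero]
  · simp

lemma coords_unitaryChannel {d : ℕ} (U : Matrix.unitaryGroup (Fin d) ℂ) :
    coords (unitaryChannel U) = (1 / d * ((U : Mat d) * (U : Mat d).map star).trace.re,
      1 / d * Complex.normSq (U : Mat d).trace) := by
  have hre : ∀ z : ℂ, (1 / (d : ℂ) * z).re = 1 / d * z.re := by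
    intro z
    have : (1 / (d : ℂ)) = ((1 / d : ℝ) : ℂ) := by push_cast; rfl
    rw [this, Complex.re_ofReal_mul]
  rw [coords_eq_sum, hre, hre]
  simp only [unitaryChannel_single]
  congr 2
  · congr 1
    simp only [Matrix.trace, Matrix.diag_apply, Matrix.mul_apply, Matrix.map_apply]
    rw [Finset.sum_comm]
  · have : ∑ i, ∑ j, (U : Mat d) i i * star ((U : Mat d) j j) =
        (Complex.normSq (U : Mat d).trace : ℂ) := by
      rw [← Complex.mul_conj, Matrix.trace, map_sum, Finset.sum_mul_sum]
      rfl
    rw [this, Complex.ofReal_re]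

lemma isUnitaryMixture_unitaryChannel {d : ℕ} (U : Matrix.unitaryGroup (Fin d) ℂ) :
    IsUnitaryMixture (unitaryChannel U) :=
  ⟨1, fun _ => 1, fun _ => U, by simp, by simp, by simp⟩

lemma unitaryMixtures_eq_convexHull (d : ℕ) :
    unitaryMixtures d = convexHull ℝ (Set.range (unitaryChannel (d := d))) := by
  refine Set.Subset.antisymm ?_ (convexHull_min ?_ ?_)
  · rintro T ⟨N, p, U, hp, hsum, hT⟩
    have hT' : T = ∑ i, p i • unitaryChannel (U i) := by
      refine LinearMap.ext fun ρ => ?_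
      rw [hT, LinearMap.sum_apply]
      exact Finset.sum_congr rfl fun i _ => by
        rw [LinearMap.smul_apply, Complex.coe_smul]
    rw [hT']
    exact (convex_convexHull ℝ _).sum_mem (fun i _ => (hp i).le) hsum
      fun i _ => subset_convexHull ℝ _ ⟨U i, rfl⟩
  · rintro _ ⟨U, rfl⟩
    exact isUnitaryMixture_unitaryChannel U
  -- Mixtures need strictly positive probabilities, so only positive weights a, b are considered;
  -- the two families are then rescaled and concatenated.
  · rw [convex_iff_forall_pos]
    rintro T ⟨N, p, U, hp, hsum, hT⟩ S ⟨M, q, V, hq, hsum', hS⟩ a b ha hb hab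
    refine ⟨N + M, Fin.append (fun i => a * p i) (fun i => b * q i), Fin.append U V, ?_, ?_, ?_⟩
    · intro i
      refine Fin.addCases (fun i => ?_) (fun i => ?_) i
      · simpa using mul_pos ha (hp i)
      · simpa using mul_pos hb (hq i)
    · simp [Fin.sum_univ_add, ← Finset.mul_sum, hsum, hsum', hab]
    · intro ρ
      simp [Fin.sum_univ_add, hT, hS, Finset.smul_sum, mul_smul]

lemma coords_image_unitaryMixtures (d : ℕ) :
    coords '' unitaryMixtures d =
      convexHull ℝ (Set.range fun U : Matrix.unitaryGroup (Fin d) ℂ =>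
        coords (unitaryChannel U)) := by
  rw [unitaryMixtures_eq_convexHull]
  have := (coordsLin d).image_convexHull (Set.range (unitaryChannel (d := d)))
  rw [← Set.range_comp] at this
  exact this

/-! ### Unitary channels lie in the region -/

/-- The planar region described by the flip bounds and the trace bound. -/
def region (d : ℕ) : Set (ℝ × ℝ) :=
  {z | (-1 + 2 / d ≤ z.1 ∧ z.1 ≤ 1) ∧ 0 ≤ z.2 ∧ z.2 ≤ d * maxTrace d z.1 ^ 2}

lemma normSq_sum_mul_le {ι : Type*} [Fintype ι] (a b : ι → ℂ) :
    Complex.normSq (∑ k, a k * b k) ≤ (∑ k, Complex.normSq (a k)) * ∑ k, Complex.normSq (b k) := by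
  have h1 : ‖∑ k, a k * b k‖ ≤ ∑ k, ‖a k‖ * ‖b k‖ := by
    refine (norm_sum_le _ _).trans (le_of_eq ?_)
    simp
  have h2 := Finset.sum_mul_sq_le_sq_mul_sq Finset.univ (fun k => ‖a k‖) (fun k => ‖b k‖)
  simp only [Complex.normSq_eq_norm_sq]
  exact (pow_le_pow_left₀ (norm_nonneg _) h1 2).trans h2

lemma sum_normSq_sub {ι : Type*} [Fintype ι] (a b : ι → ℂ) :
    ∑ k, Complex.normSq (a k - b k) = ∑ k, Complex.normSq (a k) -
      2 * (∑ k, a k * star (b k)).re + ∑ k, Complex.normSq (b k) := by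
  rw [Complex.re_sum, Finset.mul_sum, ← Finset.sum_sub_distrib, ← Finset.sum_add_distrib]
  refine Finset.sum_congr rfl fun k _ => ?_
  rw [Complex.normSq_sub, Complex.star_def]
  ring

lemma sum_normSq_mulVec {d : ℕ} {U : Mat d} (hU : U ∈ Matrix.unitaryGroup (Fin d) ℂ)
    (v : Fin d → ℂ) :
    ∑ i, Complex.normSq ((U *ᵥ v) i) = ∑ i, Complex.normSq (v i) := by
  have key : ∀ w : Fin d → ℂ, ((∑ i, Complex.normSq (w i) : ℝ) : ℂ) = star w ⬝ᵥ w := by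
    intro w
    simp [dotProduct, Complex.normSq_eq_conj_mul_self]
  have h : star (U *ᵥ v) ⬝ᵥ (U *ᵥ v) = star v ⬝ᵥ v := by
    rw [Matrix.star_mulVec, Matrix.dotProduct_mulVec, Matrix.vecMul_vecMul,
      ← Matrix.star_eq_conjTranspose, Matrix.mem_unitaryGroup_iff'.1 hU, Matrix.vecMul_one]
  rw [← key, ← key] at h
  exact_mod_cast h

lemma sum_normSq_unitary {d : ℕ} {U : Mat d} (hU : U ∈ Matrix.unitaryGroup (Fin d) ℂ) :
    ∑ i, ∑ j, Complex.normSq (U i j) = d := by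
  have h : ∀ i, ∑ j, Complex.normSq (U i j) = 1 := by
    intro i
    have := congrFun (congrFun (Matrix.mem_unitaryGroup_iff.1 hU) i) i
    rw [Matrix.mul_apply, Matrix.one_apply_eq] at this
    have h2 : ((∑ j, Complex.normSq (U i j) : ℝ) : ℂ) = 1 := by
      rw [← this]
      push_cast
      exact Finset.sum_congr rfl fun j _ => by rw [← Complex.mul_conj]; rfl
    exact_mod_cast h2
  simp [h]

/-- An antisymmetric matrix of odd size has a unit vector in its kernel. -/
lemma exists_unit_mulVec_eq_transpose {d : ℕ} (hodd : Odd d) (U : Mat d) :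
    ∃ v : Fin d → ℂ, ∑ i, Complex.normSq (v i) = 1 ∧ U *ᵥ v = Uᵀ *ᵥ v := by
  -- Transposition negates the matrix but preserves its determinant, so in odd size the determinant
  -- equals its own negative.
  have hdet : (U - Uᵀ).det = 0 := by
    have h1 : (U - Uᵀ)ᵀ = -(U - Uᵀ) := by simp
    have h2 := congrArg Matrix.det h1
    rw [Matrix.det_transpose, Matrix.det_neg, Fintype.card_fin, hodd.neg_one_pow] at h2
    linear_combination h2 / 2
  obtain ⟨v, hv, hv0⟩ := Matrix.exists_mulVec_eq_zero_iff.2 hdet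
  have hpos : 0 < ∑ i, Complex.normSq (v i) := by
    obtain ⟨i, hi⟩ := Function.ne_iff.1 hv
    exact Finset.sum_pos' (fun _ _ => Complex.normSq_nonneg _)
      ⟨i, Finset.mem_univ i, Complex.normSq_pos.2 hi⟩
  set n := ∑ i, Complex.normSq (v i) with hn
  refine ⟨((Real.sqrt n)⁻¹ : ℝ) • v, ?_, ?_⟩
  · have : ∀ i, Complex.normSq ((((Real.sqrt n)⁻¹ : ℝ) • v) i) = n⁻¹ * Complex.normSq (v i) := by
      intro i
      rw [Pi.smul_apply, Complex.real_smul, Complex.normSq_mul, Complex.normSq_ofReal, ← mul_inv,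
        Real.mul_self_sqrt hpos.le]
    simp only [this]
    rw [← Finset.mul_sum, ← hn, inv_mul_cancel₀ hpos.ne']
  · rw [Matrix.sub_mulVec, sub_eq_zero] at hv0
    rw [Matrix.mulVec_smul, Matrix.mulVec_smul, hv0]

/-- The squared Frobenius norm of the symmetric part of `U`. -/
noncomputable def symNormSq {d : ℕ} (U : Mat d) : ℝ :=
  ∑ p : Fin d × Fin d, Complex.normSq ((U p.1 p.2 + U p.2 p.1) / 2)

lemma re_trace_mul_map_star {d : ℕ} (U : Mat d) :
    (U * U.map star).trace.re = ∑ i, ∑ j, (U i j * star (U j i)).re := by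
  simp [Matrix.trace, Matrix.mul_apply]

/-- Expanding the square gives two copies of ‖U‖² = d and the cross term tr(U Ū). The first
coordinate thereby becomes 2s/d - 1 with s = `symNormSq U`. -/
lemma symNormSq_eq {d : ℕ} {U : Mat d} (hU : U ∈ Matrix.unitaryGroup (Fin d) ℂ) :
    symNormSq U = (d + (U * U.map star).trace.re) / 2 := by
  have h1 := sum_normSq_unitary hU
  have h2 : ∑ i, ∑ j, Complex.normSq (U j i) = d := by rw [Finset.sum_comm]; exact h1
  have h3 : ∀ i j, Complex.normSq ((U i j + U j i) / 2) =
      (Complex.normSq (U i j) + Complex.normSq (U j i) + 2 * (U i j * star (U j i)).re) / 4 := by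
    intro i j
    rw [Complex.normSq_div, Complex.normSq_add, Complex.star_def]
    norm_num
  rw [symNormSq, Fintype.sum_prod_type]
  simp only [h3]
  simp only [← Finset.sum_div, Finset.sum_add_distrib, ← Finset.mul_sum]
  rw [h1, h2, re_trace_mul_map_star]
  ring

lemma re_trace_mul_map_star_le {d : ℕ} {U : Mat d} (hU : U ∈ Matrix.unitaryGroup (Fin d) ℂ) :
    (U * U.map star).trace.re ≤ d := by
  have h1 := sum_normSq_unitary hU
  have h2 : ∑ i, ∑ j, Complex.normSq (U j i) = d := by rw [Finset.sum_comm]; exact h1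
  have h3 : ∀ i j, (U i j * star (U j i)).re ≤
      (Complex.normSq (U i j) + Complex.normSq (U j i)) / 2 := by
    intro i j
    have := Complex.normSq_nonneg (U i j - U j i)
    rw [Complex.normSq_sub] at this
    rw [Complex.star_def]
    linarith
  rw [re_trace_mul_map_star]
  refine (Finset.sum_le_sum fun i _ => Finset.sum_le_sum fun j _ => h3 i j).trans ?_
  simp only [← Finset.sum_div, Finset.sum_add_distrib]
  rw [h1, h2]
  linarith

/-- The symmetric part S maps a unit vector v to a unit vector w, so w v† is its component along a
unit matrix: this costs 1 in ‖S‖² and contributes at most 1 to the trace. The rest annihilates v, so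
its trace sees only the projector 1 - v v† of rank d - 1. -/
lemma symNormSq_bounds {d : ℕ} (hodd : Odd d) {U : Mat d}
    (hU : U ∈ Matrix.unitaryGroup (Fin d) ℂ) :
    1 ≤ symNormSq U ∧ ‖U.trace‖ ≤ 1 + Real.sqrt ((d - 1) * (symNormSq U - 1)) := by
  obtain ⟨v, hv, hUv⟩ := exists_unit_mulVec_eq_transpose hodd U
  set w := U *ᵥ v with hw
  have hwn : ∑ i, Complex.normSq (w i) = 1 := (sum_normSq_mulVec hU v).trans hv
  have hS : ∀ i, ∑ j, (U i j + U j i) / 2 * v j = w i := by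
    intro i
    have e1 : ∑ j, U i j * v j = w i := rfl
    have e2 : ∑ j, U j i * v j = w i := by rw [hUv]; rfl
    have : ∀ j, (U i j + U j i) / 2 * v j = (U i j * v j + U j i * v j) / 2 := fun j => by ring
    simp only [this]
    rw [← Finset.sum_div, Finset.sum_add_distrib, e1, e2]
    ring
  have hmulconj : ∀ x : Fin d → ℂ, ∑ i, Complex.normSq (x i) = 1 →
      ∑ i, x i * star (x i) = 1 := by
    intro x hx
    have : ((∑ i, Complex.normSq (x i) : ℝ) : ℂ) = 1 := by rw [hx]; simp
    rw [← this]
    push_cast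
    exact Finset.sum_congr rfl fun j _ => by rw [← Complex.mul_conj]; rfl
  have hprod : ∀ x y : Fin d → ℂ, ∑ i, Complex.normSq (x i) = 1 → ∑ i, Complex.normSq (y i) = 1 →
      ∑ p : Fin d × Fin d, Complex.normSq (x p.1 * star (y p.2)) = 1 := by
    intro x y hx hy
    rw [Fintype.sum_prod_type]
    simp only [Complex.normSq_mul, Complex.star_def, Complex.normSq_conj, ← Finset.mul_sum, hy,
      mul_one, hx]
  -- R = S - w v†. Since ⟨w, S v⟩ = 1, the matrix w v† is the orthogonal projection of S onto its
  -- own direction, whence ‖R‖² = ‖S‖² - 1.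
  set R : Fin d × Fin d → ℂ := fun p => (U p.1 p.2 + U p.2 p.1) / 2 - w p.1 * star (v p.2) with hR
  have hRn : ∑ p, Complex.normSq (R p) = symNormSq U - 1 := by
    have hc : ∑ p : Fin d × Fin d, (U p.1 p.2 + U p.2 p.1) / 2 * star (w p.1 * star (v p.2)) =
        1 := by
      rw [Fintype.sum_prod_type, ← hmulconj w hwn]
      refine Finset.sum_congr rfl fun i _ => ?_
      rw [← hS i, Finset.sum_mul]
      refine Finset.sum_congr rfl fun j _ => ?_
      rw [hS i, star_mul', star_star]
      ring
    rw [hR, sum_normSq_sub, hc, hprod w v hwn hv, symNormSq]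
    norm_num
    ring
  refine ⟨?_, ?_⟩
  · have : 0 ≤ ∑ p, Complex.normSq (R p) := Finset.sum_nonneg fun _ _ => Complex.normSq_nonneg _
    linarith
  -- Q is the transpose of 1 - v v†, so the entrywise pairing with R is tr(R (1 - v v†)).
  set Q : Fin d × Fin d → ℂ := fun p => (if p.1 = p.2 then 1 else 0) - v p.2 * star (v p.1) with hQ
  have hQn : ∑ p, Complex.normSq (Q p) = d - 1 := by
    have hc : ∑ p : Fin d × Fin d, (if p.1 = p.2 then (1 : ℂ) else 0) *
        star (v p.2 * star (v p.1)) = 1 := by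
      rw [Fintype.sum_prod_type]
      simpa [mul_comm] using hmulconj v hv
    have h1 : ∑ p : Fin d × Fin d, Complex.normSq (if p.1 = p.2 then (1 : ℂ) else 0) = d := by
      rw [Fintype.sum_prod_type]
      simp [apply_ite Complex.normSq]
    have h2 : ∑ p : Fin d × Fin d, Complex.normSq (v p.2 * star (v p.1)) = 1 := by
      rw [← hprod v v hv hv, Fintype.sum_prod_type, Finset.sum_comm, Fintype.sum_prod_type]
    rw [hQ, sum_normSq_sub, hc, h1, h2]
    norm_num
    ring
  -- R v = 0 makes the pairing equal to tr R, and tr S = tr U.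
  have hRQ : ∑ p, R p * Q p = U.trace - ∑ i, w i * star (v i) := by
    have hRv : ∀ i, ∑ j, R (i, j) * v j = 0 := by
      intro i
      have : ∀ j, R (i, j) * v j = (U i j + U j i) / 2 * v j - w i * (v j * star (v j)) := by
        intro j
        simp only [hR]
        ring
      simp only [this]
      rw [Finset.sum_sub_distrib, hS, ← Finset.mul_sum, hmulconj v hv]
      ring
    have h1 : ∀ i, ∑ j, R (i, j) * Q (i, j) = R (i, i) - star (v i) * ∑ j, R (i, j) * v j := by
      intro i
      rw [Finset.mul_sum]
      have : ∀ j, R (i, j) * Q (i, j) =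
          (if i = j then R (i, j) else 0) - star (v i) * (R (i, j) * v j) := by
        intro j
        simp only [hQ]
        split_ifs <;> ring
      simp only [this]
      rw [Finset.sum_sub_distrib, Finset.sum_ite_eq]
      simp
    rw [Fintype.sum_prod_type]
    simp only [h1, hRv, mul_zero, sub_zero]
    simp only [hR, Finset.sum_sub_distrib]
    congr 1
    exact Finset.sum_congr rfl fun i _ => by rw [Matrix.diag_apply]; ring
  have hb1 : ‖∑ p, R p * Q p‖ ≤ Real.sqrt ((d - 1) * (symNormSq U - 1)) := by
    refine Real.le_sqrt_of_sq_le ?_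
    rw [← Complex.normSq_eq_norm_sq]
    refine (normSq_sum_mul_le R Q).trans (le_of_eq ?_)
    rw [hRn, hQn, mul_comm]
  have hb2 : ‖∑ i, w i * star (v i)‖ ≤ 1 := by
    have := normSq_sum_mul_le w (fun i => star (v i))
    simp only [Complex.star_def, Complex.normSq_conj] at this
    rw [hv, hwn, Complex.normSq_eq_norm_sq] at this
    simp only [Complex.star_def]
    nlinarith [norm_nonneg (∑ i, w i * (starRingEnd ℂ) (v i))]
  have : U.trace = ∑ i, w i * star (v i) + ∑ p, R p * Q p := by rw [hRQ]; ring
  rw [this]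
  exact (norm_add_le _ _).trans (add_le_add hb2 hb1)

/-- In the parameter s = ‖S‖², with x = 2s/d - 1, the function m is exactly the trace bound divided
by d. -/
lemma maxTrace_eq {d : ℕ} (hd : d ≠ 0) (s : ℝ) :
    maxTrace d (2 * s / d - 1) = (1 + Real.sqrt ((d - 1) * (s - 1))) / d := by
  have hd' : (0 : ℝ) < d := by exact_mod_cast Nat.pos_of_ne_zero hd
  have : 1 / 2 * (1 - 1 / (d : ℝ)) * (1 - 2 / d + (2 * s / d - 1)) =
      (d - 1) * (s - 1) / (d : ℝ) ^ 2 := by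
    field_simp
    ring
  rw [maxTrace, this, Real.sqrt_div' _ (by positivity), Real.sqrt_sq hd'.le]
  ring

lemma coords_unitaryChannel_mem_region {d : ℕ} (hodd : Odd d)
    (U : Matrix.unitaryGroup (Fin d) ℂ) : coords (unitaryChannel U) ∈ region d := by
  have hd : d ≠ 0 := hodd.pos.ne'
  have hd' : (0 : ℝ) < d := by exact_mod_cast hodd.pos
  obtain ⟨h1, h2⟩ := symNormSq_bounds hodd U.2
  have h3 := symNormSq_eq U.2
  have h4 := re_trace_mul_map_star_le U.2
  have hx : 1 / d * ((U : Mat d) * (U : Mat d).map star).trace.re =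
      2 * symNormSq (U : Mat d) / d - 1 := by
    rw [h3]
    field_simp
    ring
  rw [coords_unitaryChannel]
  refine ⟨⟨?_, ?_⟩, ?_, ?_⟩
  · simp only [hx]
    have : (2 : ℝ) / d ≤ 2 * symNormSq (U : Mat d) / d := by gcongr; linarith
    linarith
  · rw [one_div, inv_mul_le_iff₀ hd']
    simpa using h4
  · exact mul_nonneg (by positivity) (Complex.normSq_nonneg _)
  · simp only [hx]
    rw [maxTrace_eq hd, Complex.normSq_eq_norm_sq, div_pow]
    have := pow_le_pow_left₀ (norm_nonneg _) h2 2
    have e : (d : ℝ) * ((1 + Real.sqrt ((d - 1) * (symNormSq (U : Mat d) - 1))) ^ 2 / d ^ 2) =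
        1 / d * (1 + Real.sqrt ((d - 1) * (symNormSq (U : Mat d) - 1))) ^ 2 := by
      field_simp
    rw [e]
    gcongr

/-! ### Unitaries realizing the curve and the two corners -/

/-- The matrix with `a` on the diagonal and `b i` at the positions `(i, σ i)`. -/
def involutionMatrix {n R : Type*} [DecidableEq n] [AddZeroClass R] (σ : n → n) (a b : n → R) :
    Matrix n n R :=
  Matrix.of fun i j => (if i = j then a i else 0) + if σ i = j then b i else 0

lemma involutionMatrix_apply {n R : Type*} [DecidableEq n] [AddZeroClass R] (σ : n → n)
    (a b : n → R) (i j : n) : involutionMatrix σ a b i j =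
      (if i = j then a i else 0) + if σ i = j then b i else 0 := rfl

/-- A row is supported on i and σ i, so distinct rows overlap only within an orbit of σ: `h1`
handles the diagonal and `h2` the entries (i, σ i). At a fixed point the two entries coincide and
the sum of both equations is needed. -/
lemma involutionMatrix_mul_conjTranspose {n R : Type*} [Fintype n] [DecidableEq n] [CommRing R]
    [StarRing R] {σ : n → n} (hσ : Function.Involutive σ) {a b : n → R}
    (h1 : ∀ i, a i * star (a i) + b i * star (b i) = 1)
    (h2 : ∀ i, a i * star (b (σ i)) + b i * star (a (σ i)) = 0) :
    involutionMatrix σ a b * (involutionMatrix σ a b)ᴴ = 1 := by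
  ext i j
  have e : ∀ k, involutionMatrix σ a b i k * star (involutionMatrix σ a b j k) =
      (if i = k then a i * star (involutionMatrix σ a b j k) else 0) +
      (if σ i = k then b i * star (involutionMatrix σ a b j k) else 0) := by
    intro k
    rw [involutionMatrix_apply σ a b i k, add_mul, ite_mul, ite_mul, zero_mul]
  rw [Matrix.mul_apply]
  simp only [Matrix.conjTranspose_apply, e, Finset.sum_add_distrib, Finset.sum_ite_eq,
    Finset.mem_univ, if_true]
  simp only [involutionMatrix, Matrix.of_apply, star_add, apply_ite star, star_zero, mul_add,
    hσ.injective.eq_iff, Matrix.one_apply]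
  by_cases hij : j = i
  · subst hij
    by_cases hf : σ j = j
    · have := h2 j
      rw [hf] at this
      simp only [hf, if_true]
      linear_combination h1 j + this
    · have hf' : ¬ j = σ j := fun h => hf h.symm
      simp only [hf, hf', if_true, if_false]
      linear_combination h1 j
  · have hij' : ¬ i = j := fun h => hij h.symm
    by_cases hf : σ j = i
    · have hf' : j = σ i := by rw [← hf, hσ]
      have := h2 i
      rw [← hf'] at this
      simp only [hij, hij', hf, ← hf', if_true, if_false]
      linear_combination this
    · have hf' : ¬ j = σ i := fun h => hf (by rw [h, hσ])
      simp [hij, hij', hf, hf']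

lemma involutionMatrix_trace {n R : Type*} [Fintype n] [DecidableEq n] [CommRing R]
    (σ : n → n) (a b : n → R) :
    (involutionMatrix σ a b).trace = ∑ i, (a i + if σ i = i then b i else 0) := by
  simp [Matrix.trace, involutionMatrix]

lemma involutionMatrix_trace_mul_map_star {n R : Type*} [Fintype n] [DecidableEq n] [CommRing R]
    [StarRing R] {σ : n → n} (hσ : Function.Involutive σ) {a b : n → R}
    (hb : ∀ i, σ i = i → b i = 0) :
    (involutionMatrix σ a b * (involutionMatrix σ a b).map star).trace =
      ∑ i, (a i * star (a i) + b i * star (b (σ i))) := by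
  simp only [Matrix.trace, Matrix.diag_apply, Matrix.mul_apply, Matrix.map_apply]
  refine Finset.sum_congr rfl fun i _ => ?_
  have e : ∀ k, involutionMatrix σ a b i k * star (involutionMatrix σ a b k i) =
      (if i = k then a i * star (involutionMatrix σ a b k i) else 0) +
      (if σ i = k then b i * star (involutionMatrix σ a b k i) else 0) := by
    intro k
    rw [involutionMatrix_apply σ a b i k, add_mul, ite_mul, ite_mul, zero_mul]
  simp only [e, Finset.sum_add_distrib, Finset.sum_ite_eq, Finset.mem_univ, if_true]
  by_cases hf : σ i = i
  · simp [involutionMatrix, hf, hb i hf]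
  · simp [involutionMatrix, hf, hσ i]

/-- A sign that is odd under `Fin.rev` and vanishes exactly at the middle index. -/
def revSign (k : ℕ) (i : Fin (2 * k + 1)) : ℝ :=
  if (i : ℕ) < k then 1 else if (i : ℕ) = k then 0 else -1

lemma revSign_rev (k : ℕ) (i : Fin (2 * k + 1)) : revSign k i.rev = -revSign k i := by
  have := i.2
  have hr := Fin.val_rev i
  rcases lt_trichotomy (i : ℕ) k with h | h | h
  · have h1 : ¬ (i.rev : ℕ) < k := by omega
    have h2 : ¬ (i.rev : ℕ) = k := by omega
    simp only [revSign, h, h1, h2, if_true, if_false]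
  · have h1 : ¬ (i.rev : ℕ) < k := by omega
    have h2 : (i.rev : ℕ) = k := by omega
    have h3 : ¬ (i : ℕ) < k := by omega
    simp only [revSign, h2, h, if_true, if_false, neg_zero, lt_irrefl]
  · have h1 : (i.rev : ℕ) < k := by omega
    have h2 : ¬ (i : ℕ) = k := by omega
    have h3 : ¬ (i : ℕ) < k := by omega
    simp only [revSign, h1, h2, h3, if_true, if_false, neg_neg]

lemma revSign_mul_self (k : ℕ) (i : Fin (2 * k + 1)) :
    revSign k i * revSign k i = if (i : ℕ) = k then 0 else 1 := by
  rcases lt_trichotomy (i : ℕ) k with h | h | h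
  · simp [revSign, h, h.ne]
  · simp [revSign, h]
  · have h3 : ¬ (i : ℕ) < k := by omega
    simp [revSign, h3, h.ne']

lemma rev_eq_self_iff (k : ℕ) (i : Fin (2 * k + 1)) : i.rev = i ↔ (i : ℕ) = k := by
  rw [Fin.ext_iff, Fin.val_rev]
  omega

lemma revSign_eq_zero (k : ℕ) (i : Fin (2 * k + 1)) (h : i.rev = i) : revSign k i = 0 := by
  have := (rev_eq_self_iff k i).1 h
  simp [revSign, this]

/-- The rotation by an angle with cosine `c` and sine `s` in each plane spanned by `i` and
`i.rev`, fixing the middle coordinate. -/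
noncomputable def blockRotation (k : ℕ) (c s : ℝ) : Mat (2 * k + 1) :=
  involutionMatrix Fin.rev (fun i => if (i : ℕ) = k then 1 else (c : ℂ))
    (fun i => ((s * revSign k i : ℝ) : ℂ))

lemma sum_ite_val_eq {k : ℕ} (x y : ℝ) :
    ∑ i : Fin (2 * k + 1), (if (i : ℕ) = k then x else y) = x + 2 * k * y := by
  have h : ∀ i : Fin (2 * k + 1), (if (i : ℕ) = k then x else y) =
      (if (⟨k, by omega⟩ : Fin (2 * k + 1)) = i then x - y else 0) + y := by
    intro i
    by_cases hi : (i : ℕ) = k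
    · simp [hi, Fin.ext_iff]
    · simp [hi, Fin.ext_iff, Ne.symm hi]
  simp only [h, Finset.sum_add_distrib, Finset.sum_ite_eq, Finset.mem_univ, if_true]
  simp
  ring

lemma blockRotation_mem (k : ℕ) {c s : ℝ} (h : c ^ 2 + s ^ 2 = 1) :
    blockRotation k c s ∈ Matrix.unitaryGroup (Fin (2 * k + 1)) ℂ := by
  rw [Matrix.mem_unitaryGroup_iff]
  refine involutionMatrix_mul_conjTranspose Fin.rev_involutive (fun i => ?_) (fun i => ?_)
  · have e : (((s * revSign k i : ℝ)) : ℂ) * star ((s * revSign k i : ℝ) : ℂ) =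
        ((s ^ 2 * if (i : ℕ) = k then 0 else 1 : ℝ) : ℂ) := by
      rw [← revSign_mul_self, Complex.star_def, Complex.conj_ofReal]
      push_cast
      ring
    rw [e]
    by_cases hi : (i : ℕ) = k
    · simp [hi]
    · simp only [hi, if_false, Complex.star_def, Complex.conj_ofReal, mul_one]
      rw [← Complex.ofReal_mul, ← Complex.ofReal_add, ← sq, h, Complex.ofReal_one]
  · by_cases hi : i.rev = i
    · simp [revSign_eq_zero k i hi, revSign_eq_zero k i.rev (by rw [hi, hi])]
    · have h1 : ¬ (i : ℕ) = k := fun h => hi ((rev_eq_self_iff k i).2 h)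
      have h2 : ¬ (i.rev : ℕ) = k := fun h =>
        hi (((rev_eq_self_iff k i.rev).2 h).symm.trans (Fin.rev_rev i))
      simp only [h1, h2, if_false, revSign_rev, Complex.star_def, Complex.conj_ofReal]
      push_cast
      ring

lemma coords_blockRotation (k : ℕ) {c s : ℝ} (h : c ^ 2 + s ^ 2 = 1) :
    coords (unitaryChannel ⟨blockRotation k c s, blockRotation_mem k h⟩) =
      (1 / (2 * k + 1 : ℕ) * (1 + 2 * k * (c ^ 2 - s ^ 2)),
        1 / (2 * k + 1 : ℕ) * (1 + 2 * k * c) ^ 2) := by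
  rw [coords_unitaryChannel]
  have h1 : (blockRotation k c s).trace = ((1 + 2 * k * c : ℝ) : ℂ) := by
    rw [blockRotation, involutionMatrix_trace, ← sum_ite_val_eq, Complex.ofReal_sum]
    refine Finset.sum_congr rfl fun i _ => ?_
    by_cases hi : i.rev = i
    · simp [revSign_eq_zero k i hi, apply_ite Complex.ofReal]
    · simp [hi, apply_ite Complex.ofReal]
  have h2 : (blockRotation k c s * (blockRotation k c s).map star).trace =
      ((1 + 2 * k * (c ^ 2 - s ^ 2) : ℝ) : ℂ) := by
    rw [blockRotation, involutionMatrix_trace_mul_map_star Fin.rev_involutive, ← sum_ite_val_eq,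
      Complex.ofReal_sum]
    · refine Finset.sum_congr rfl fun i _ => ?_
      have e : (((s * revSign k i : ℝ)) : ℂ) * star ((s * revSign k i.rev : ℝ) : ℂ) =
          ((-(s ^ 2 * if (i : ℕ) = k then 0 else 1) : ℝ) : ℂ) := by
        rw [← revSign_mul_self, revSign_rev, Complex.star_def, Complex.conj_ofReal]
        push_cast
        ring
      rw [e]
      by_cases hi : (i : ℕ) = k
      · simp [hi]
      · simp only [hi, if_false, Complex.star_def, Complex.conj_ofReal]
        push_cast
        ring
    · intro i hi
      simp [revSign_eq_zero k i hi]
  simp only [h1, h2, Complex.ofReal_re, Complex.normSq_ofReal, sq]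

lemma exists_coords_eq_curve {d : ℕ} (hd : 3 ≤ d) (hodd : Odd d) {x : ℝ}
    (hx : x ∈ Set.Icc (-1 + 2 / d : ℝ) 1) :
    ∃ U : Matrix.unitaryGroup (Fin d) ℂ,
      coords (unitaryChannel U) = (x, d * maxTrace d x ^ 2) := by
  obtain ⟨k, rfl⟩ := hodd
  have hk : (1 : ℝ) ≤ k := by exact_mod_cast (by omega : 1 ≤ k)
  have hD : ((2 * k + 1 : ℕ) : ℝ) = 2 * k + 1 := by push_cast; rfl
  rw [hD] at hx
  obtain ⟨hx1, hx2⟩ := hx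
  have hDpos : (0 : ℝ) < 2 * k + 1 := by linarith
  -- t is the squared cosine of the rotation angle: solve x = (1 + 2k(2t - 1))/(2k + 1) for t. The
  -- range of x is exactly 0 ≤ t ≤ 1.
  set t : ℝ := ((1 + x) * (2 * k + 1) / 2 - 1) / (2 * k) with ht
  have ht0 : 0 ≤ t := by
    have : 2 / (2 * k + 1 : ℝ) ≤ 1 + x := by linarith
    rw [div_le_iff₀ hDpos] at this
    apply div_nonneg <;> linarith
  have ht1 : t ≤ 1 := by
    rw [ht, div_le_one (by linarith)]
    nlinarith
  have hcs : Real.sqrt t ^ 2 + Real.sqrt (1 - t) ^ 2 = 1 := by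
    rw [Real.sq_sqrt ht0, Real.sq_sqrt (by linarith)]
    ring
  refine ⟨⟨_, blockRotation_mem k hcs⟩, ?_⟩
  have hxs : x = 2 * (1 + 2 * k * t) / (2 * k + 1 : ℕ) - 1 := by
    rw [hD, ht]
    field_simp
    ring
  have hm : maxTrace (2 * k + 1) x = (1 + 2 * k * Real.sqrt t) / (2 * k + 1 : ℕ) := by
    rw [hxs, maxTrace_eq (by omega), hD]
    congr 2
    have : (2 * (k : ℝ) + 1 - 1) * (1 + 2 * k * t - 1) = (2 * k) ^ 2 * t := by ring
    rw [this, Real.sqrt_mul (by positivity), Real.sqrt_sq (by linarith)]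
  rw [coords_blockRotation k hcs, hm, Real.sq_sqrt ht0, Real.sq_sqrt (by linarith : 0 ≤ 1 - t), hxs, hD]
  ext
  · simp only
    field_simp
    ring
  · simp only
    field_simp

/-- A diagonal unitary channel with trace zero. -/
lemma exists_coords_eq_one_zero {d : ℕ} (hd : 2 ≤ d) :
    ∃ U : Matrix.unitaryGroup (Fin d) ℂ, coords (unitaryChannel U) = (1, 0) := by
  have hd' : d ≠ 0 := by omega
  -- The powers of a primitive d-th root of unity sum to zero, while a diagonal unitary satisfies U
  -- Ū = 1.
  set ζ := Complex.exp (2 * Real.pi * Complex.I / d) with hζ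
  have hprim : IsPrimitiveRoot ζ d := Complex.isPrimitiveRoot_exp d hd'
  have hnorm : ζ * star ζ = 1 := by
    rw [Complex.star_def, Complex.mul_conj, Complex.normSq_eq_norm_sq,
      hprim.norm'_eq_one hd']
    simp
  have hn : ∀ i : ℕ, ζ ^ i * star (ζ ^ i) = 1 := by
    intro i
    rw [star_pow, ← mul_pow, hnorm, one_pow]
  have hmem : Matrix.diagonal (fun i : Fin d => ζ ^ (i : ℕ)) ∈ Matrix.unitaryGroup (Fin d) ℂ := by
    rw [Matrix.mem_unitaryGroup_iff, Matrix.star_eq_conjTranspose, Matrix.diagonal_conjTranspose,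
      Matrix.diagonal_mul_diagonal, ← Matrix.diagonal_one]
    congr 1
    funext i
    exact hn i
  refine ⟨⟨_, hmem⟩, ?_⟩
  rw [coords_unitaryChannel]
  have h1 : (Matrix.diagonal (fun i : Fin d => ζ ^ (i : ℕ))).trace = 0 := by
    rw [Matrix.trace_diagonal, Fin.sum_univ_eq_sum_range (fun i => ζ ^ i)]
    exact hprim.geom_sum_eq_zero (by omega)
  have h2 : (Matrix.diagonal (fun i : Fin d => ζ ^ (i : ℕ)) *
      (Matrix.diagonal (fun i : Fin d => ζ ^ (i : ℕ))).map star).trace = d := by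
    rw [Matrix.diagonal_map (star_zero ℂ), Matrix.diagonal_mul_diagonal, Matrix.trace_diagonal]
    simp only [hn]
    simp
  simp only [h1, h2, Complex.natCast_re, map_zero, mul_zero]
  rw [one_div, inv_mul_cancel₀ (by exact_mod_cast hd')]

/-- The unitary acting on the `p`-`m` plane as `(1, 1; i, -i) / √2`. -/
noncomputable def isotropicUnitary {n : Type*} [DecidableEq n] (p m : n) : Matrix n n ℂ :=
  involutionMatrix (Equiv.swap p m)
    (fun i => if i = p then ((Real.sqrt 2)⁻¹ : ℝ) else
      if i = m then -Complex.I * ((Real.sqrt 2)⁻¹ : ℝ) else 1)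
    (fun i => if i = p then ((Real.sqrt 2)⁻¹ : ℝ) else
      if i = m then Complex.I * ((Real.sqrt 2)⁻¹ : ℝ) else 0)

lemma inv_sqrt_two_mul_self :
    (((Real.sqrt 2)⁻¹ : ℝ) : ℂ) * (((Real.sqrt 2)⁻¹ : ℝ) : ℂ) = 1 / 2 := by
  rw [← Complex.ofReal_mul, ← mul_inv, Real.mul_self_sqrt (by norm_num)]
  norm_num

lemma isotropicUnitary_mul_conjTranspose {n : Type*} [Fintype n] [DecidableEq n] {p m : n}
    (hpm : p ≠ m) : isotropicUnitary p m * (isotropicUnitary p m)ᴴ = 1 := by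
  have h2 := inv_sqrt_two_mul_self
  have hI := Complex.I_mul_I
  set r := (((Real.sqrt 2)⁻¹ : ℝ) : ℂ) with hr
  have hrs : star r = r := Complex.conj_ofReal _
  have hIs : star Complex.I = -Complex.I := Complex.conj_I
  refine involutionMatrix_mul_conjTranspose (Equiv.swap_apply_self p m) (fun i => ?_) (fun i => ?_)
  · by_cases hp : i = p
    · simp only [hp, if_true, ← hr, hrs]
      linear_combination 2 * h2
    · by_cases hm : i = m
      · simp only [hm, hpm.symm, if_true, if_false, ← hr, star_mul', star_neg, hrs, hIs]
        linear_combination 2 * h2 - 2 * r * r * hI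
      · simp [hp, hm]
  · by_cases hp : i = p
    · simp only [hp, Equiv.swap_apply_left, hpm.symm, if_true, if_false, ← hr, star_mul', star_neg,
        hrs, hIs]
      ring
    · by_cases hm : i = m
      · simp only [hm, Equiv.swap_apply_right, hpm.symm, if_true, if_false, ← hr, hrs]
        ring
      · simp [hp, hm, Equiv.swap_apply_of_ne_of_ne hp hm]

/-- Column m has entries 1/√2 and -i/√2, so it is isotropic for the bilinear form. -/
lemma sum_isotropicUnitary_sq {n : Type*} [Fintype n] [DecidableEq n] {p m : n}
    (hpm : p ≠ m) : ∑ i, isotropicUnitary p m i m * isotropicUnitary p m i m = 0 := by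
  have h2 := inv_sqrt_two_mul_self
  have hI := Complex.I_mul_I
  set r := (((Real.sqrt 2)⁻¹ : ℝ) : ℂ) with hr
  have e : ∀ i, isotropicUnitary p m i m * isotropicUnitary p m i m =
      (if p = i then 1 / 2 else 0) + (if m = i then -1 / 2 else 0) := by
    intro i
    rw [isotropicUnitary, involutionMatrix, Matrix.of_apply]
    by_cases hp : i = p
    · simp only [hp, hpm, hpm.symm, Equiv.swap_apply_left, if_true, if_false, ← hr]
      linear_combination h2
    · by_cases hm : i = m
      · simp only [hm, hpm, hpm.symm, Equiv.swap_apply_right, if_true, if_false, ← hr]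
        linear_combination - h2 + r * r * hI
      · simp [hm, Ne.symm hp, Ne.symm hm, Equiv.swap_apply_of_ne_of_ne hp hm]
  simp only [e, Finset.sum_add_distrib, Finset.sum_ite_eq, Finset.mem_univ, if_true]
  norm_num

/-- The block rotation V by a right angle already has the right first coordinate, but trace 1.
Passing to W V Wᵀ with W unitary keeps tr(U Ū) because Wᵀ W̄ = 1, and turns the trace into tr(V
WᵀW). The antisymmetric part of V does not pair with the symmetric WᵀW, and the middle entry of WᵀW
vanishes by choice of W. -/
lemma exists_coords_eq_lower_zero {d : ℕ} (hd : 3 ≤ d) (hodd : Odd d) :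
    ∃ U : Matrix.unitaryGroup (Fin d) ℂ,
      coords (unitaryChannel U) = ((-1 + 2 / d : ℝ), 0) := by
  obtain ⟨k, rfl⟩ := hodd
  set m : Fin (2 * k + 1) := ⟨k, by omega⟩ with hm
  set p : Fin (2 * k + 1) := ⟨0, by omega⟩ with hp
  have hpm : p ≠ m := by
    rw [hp, hm, Ne, Fin.mk.injEq]
    omega
  set W := isotropicUnitary p m with hW
  have hW1 : W * Wᴴ = 1 := isotropicUnitary_mul_conjTranspose hpm
  have hW2 : Wᴴ * W = 1 := mul_eq_one_comm.1 hW1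
  have hcs : (0 : ℝ) ^ 2 + 1 ^ 2 = 1 := by norm_num
  set V := blockRotation k 0 1 with hV
  have hV1 : V * Vᴴ = 1 := Matrix.mem_unitaryGroup_iff.1 (blockRotation_mem k hcs)
  have hT1 : Wᵀ * W.map star = 1 := by
    have := congrArg Matrix.transpose hW2
    rwa [Matrix.transpose_mul, Matrix.transpose_one] at this
  have hmem : W * V * Wᵀ ∈ Matrix.unitaryGroup (Fin (2 * k + 1)) ℂ := by
    rw [Matrix.mem_unitaryGroup_iff, Matrix.star_eq_conjTranspose, Matrix.conjTranspose_mul,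
      Matrix.conjTranspose_mul]
    calc W * V * Wᵀ * (Wᵀᴴ * (Vᴴ * Wᴴ)) = W * (V * ((Wᵀ * Wᵀᴴ) * Vᴴ)) * Wᴴ := by
          simp only [Matrix.mul_assoc]
      _ = 1 := by
          have : Wᵀ * Wᵀᴴ = 1 := hT1
          rw [this, Matrix.one_mul, hV1, Matrix.mul_one, hW1]
  refine ⟨⟨_, hmem⟩, ?_⟩
  have hstar : ∀ A B : Mat (2 * k + 1), (A * B).map star = A.map star * B.map star := by
    intro A B
    exact Matrix.map_mul (f := starRingEnd ℂ)
  have h2 : (W * V * Wᵀ * (W * V * Wᵀ).map star).trace = (V * V.map star).trace := by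
    rw [hstar, hstar]
    have hT2 : Wᵀ.map star * W = 1 := hW2
    calc (W * V * Wᵀ * (W.map star * V.map star * Wᵀ.map star)).trace
        = (W * (V * ((Wᵀ * W.map star) * (V.map star * Wᵀ.map star)))).trace := by
          simp only [Matrix.mul_assoc]
      _ = (V * V.map star).trace := by
          rw [hT1, Matrix.one_mul, Matrix.trace_mul_comm, ← Matrix.mul_assoc, Matrix.mul_assoc,
            hT2, Matrix.mul_one]
  have hVe : ∀ i j, V i j = (if i = j then (if i = m then 1 else 0) else 0) +
      if Fin.rev i = j then (revSign k i : ℂ) else 0 := by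
    intro i j
    rw [hV, blockRotation, involutionMatrix, Matrix.of_apply]
    simp [hm, Fin.ext_iff]
  have h1 : (W * V * Wᵀ).trace = 0 := by
    have hsym : ∀ i j, (Wᵀ * W) i j = (Wᵀ * W) j i := by
      intro i j
      have : (Wᵀ * W)ᵀ = Wᵀ * W := by rw [Matrix.transpose_mul, Matrix.transpose_transpose]
      exact congrFun (congrFun this j) i
    rw [Matrix.mul_assoc, Matrix.trace_mul_comm, Matrix.mul_assoc]
    set G := Wᵀ * W with hG
    have hGm : G m m = 0 := by
      rw [hG, Matrix.mul_apply]
      exact sum_isotropicUnitary_sq hpm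
    have e : (V * G).trace = G m m + ∑ i, (revSign k i : ℂ) * G i.rev i := by
      simp only [Matrix.trace, Matrix.diag_apply, Matrix.mul_apply, hVe, add_mul,
        Finset.sum_add_distrib, ite_mul, zero_mul, one_mul, Finset.sum_ite_eq, Finset.mem_univ,
        if_true, Finset.sum_ite_eq']
    -- Reversing the index negates the sign and leaves the symmetric G unchanged, so the sum is its
    -- own negative.
    have e2 : ∑ i, (revSign k i : ℂ) * G i.rev i = -∑ i, (revSign k i : ℂ) * G i.rev i := by
      conv_lhs => rw [← Equiv.sum_comp Fin.revPerm]
      rw [← Finset.sum_neg_distrib]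
      refine Finset.sum_congr rfl fun i _ => ?_
      rw [Fin.revPerm_apply, revSign_rev, Fin.rev_rev, hsym]
      push_cast
      ring
    rw [e, hGm]
    linear_combination e2 / 2
  have h3 := coords_blockRotation k hcs
  rw [coords_unitaryChannel] at h3 ⊢
  simp only [h1, h2, map_zero, mul_zero]
  have h4 := (Prod.ext_iff.1 h3).1
  simp only at h4
  rw [h4]
  ext
  · simp only
    push_cast
    field_simp
    ring
  · rfl

/-! ### Convexity and extreme points of the region -/

lemma sq_maxTrace_eq (d : ℕ) {x : ℝ} (hA : 0 ≤ 1 / 2 * (1 - 1 / (d : ℝ)) * (1 - 2 / d + x)) :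
    maxTrace d x ^ 2 = 1 / 2 * (1 - 1 / (d : ℝ)) * (1 - 2 / d + x) +
      2 / d * Real.sqrt (1 / 2 * (1 - 1 / (d : ℝ)) * (1 - 2 / d + x)) + (1 / d) ^ 2 := by
  rw [maxTrace, add_sq, Real.sq_sqrt hA]
  ring

/-- Expanding the square leaves an affine term plus a positive multiple of the root of an affine
function with nonzero slope c; strictness comes from the root. -/
lemma strictConcaveOn_curve {d : ℕ} (hd : 2 ≤ d) :
    StrictConcaveOn ℝ (Set.Icc (-1 + 2 / d : ℝ) 1) fun x => d * maxTrace d x ^ 2 := by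
  have hd' : (2 : ℝ) ≤ d := by exact_mod_cast hd
  have hc : 0 < 1 / 2 * (1 - 1 / (d : ℝ)) := by
    have : 1 / (d : ℝ) < 1 := by rw [div_lt_one] <;> linarith
    linarith
  set c := 1 / 2 * (1 - 1 / (d : ℝ)) with hcdef
  have hnn : ∀ x ∈ Set.Icc (-1 + 2 / d : ℝ) 1, 0 ≤ c * (1 - 2 / d + x) := by
    intro x hx
    exact mul_nonneg hc.le (by linarith [hx.1])
  refine ⟨convex_Icc _ _, fun x hx y hy hxy a b ha hb hab => ?_⟩
  have hz := (convex_Icc (-1 + 2 / d : ℝ) 1) hx hy ha.le hb.le hab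
  simp only [smul_eq_mul] at hz ⊢
  rw [sq_maxTrace_eq d (hnn x hx), sq_maxTrace_eq d (hnn y hy), sq_maxTrace_eq d (hnn _ hz),
    ← hcdef]
  have hs := Real.strictConcaveOn_sqrt.2 (hnn x hx) (hnn y hy) (fun h => hxy (by
    have := mul_left_cancel₀ hc.ne' h
    linarith)) ha hb hab
  simp only [smul_eq_mul] at hs
  have e : a * (c * (1 - 2 / d + x)) + b * (c * (1 - 2 / d + y)) =
      c * (1 - 2 / d + (a * x + b * y)) := by
    linear_combination c * (1 - 2 / d) * hab
  rw [e] at hs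
  have h2 : (0 : ℝ) < d * (2 / d) := by positivity
  have hs' := mul_lt_mul_of_pos_left hs h2
  have hb' : b = 1 - a := by linarith
  subst hb'
  linarith

lemma convex_region {d : ℕ} (hd : 2 ≤ d) : Convex ℝ (region d) := by
  rintro p ⟨hp, hp1, hp2⟩ q ⟨hq, hq1, hq2⟩ a b ha hb hab
  refine ⟨(convex_Icc (-1 + 2 / d : ℝ) 1) hp hq ha hb hab, ?_, ?_⟩
  · exact add_nonneg (mul_nonneg ha hp1) (mul_nonneg hb hq1)
  · have := (strictConcaveOn_curve hd).concaveOn.2 hp hq ha hb hab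
    refine le_trans ?_ this
    exact add_le_add (mul_le_mul_of_nonneg_left hp2 ha) (mul_le_mul_of_nonneg_left hq2 hb)

/-- Each point lies on the vertical segment from the bottom edge, spanned by the two corners, up to
the curve. -/
lemma region_subset_of_convex {d : ℕ} {s : Set (ℝ × ℝ)} (hs : Convex ℝ s)
    (h1 : ((-1 + 2 / d : ℝ), (0 : ℝ)) ∈ s) (h2 : ((1 : ℝ), (0 : ℝ)) ∈ s)
    (h3 : ∀ x ∈ Set.Icc (-1 + 2 / d : ℝ) 1, (x, d * maxTrace d x ^ 2) ∈ s) : region d ⊆ s := by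
  rintro ⟨x, y⟩ ⟨hx, hy1, hy2⟩
  simp only at hx hy1 hy2
  have hx0 : (x, (0 : ℝ)) ∈ s := by
    have : (x, (0 : ℝ)) ∈ segment ℝ ((-1 + 2 / d : ℝ), (0 : ℝ)) ((1 : ℝ), (0 : ℝ)) := by
      rw [← Prod.image_mk_segment_left, segment_eq_Icc (hx.1.trans hx.2)]
      exact ⟨x, hx, rfl⟩
    exact hs.segment_subset h1 h2 this
  have : (x, y) ∈ segment ℝ (x, (0 : ℝ)) (x, d * maxTrace d x ^ 2) := by
    rw [← Prod.image_mk_segment_right, segment_eq_Icc (hy1.trans hy2)]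
    exact ⟨y, ⟨hy1, hy2⟩, rfl⟩
  exact hs.segment_subset hx0 (h3 x hx) this

lemma convexHull_coords_eq_region {d : ℕ} (hd : 3 ≤ d) (hodd : Odd d) :
    convexHull ℝ (Set.range fun U : Matrix.unitaryGroup (Fin d) ℂ =>
      coords (unitaryChannel U)) = region d := by
  refine Set.Subset.antisymm (convexHull_min ?_ (convex_region (by omega)))
    (region_subset_of_convex (convex_convexHull ℝ _) ?_ ?_ ?_)
  · rintro _ ⟨U, rfl⟩
    exact coords_unitaryChannel_mem_region hodd U
  · obtain ⟨U, hU⟩ := exists_coords_eq_lower_zero hd hodd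
    exact subset_convexHull ℝ _ ⟨U, hU⟩
  · obtain ⟨U, hU⟩ := exists_coords_eq_one_zero (d := d) (by omega)
    exact subset_convexHull ℝ _ ⟨U, hU⟩
  · intro x hx
    obtain ⟨U, hU⟩ := exists_coords_eq_curve hd hodd hx
    exact subset_convexHull ℝ _ ⟨U, hU⟩

lemma curve_pos {d : ℕ} (hd : d ≠ 0) (x : ℝ) : 0 < d * maxTrace d x ^ 2 := by
  have : (0 : ℝ) < d := by exact_mod_cast Nat.pos_of_ne_zero hd
  have h : 0 < maxTrace d x := add_pos_of_nonneg_of_pos (Real.sqrt_nonneg _) (by positivity)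
  positivity

lemma extremePoints_region {d : ℕ} (hd : 2 ≤ d) :
    Set.extremePoints ℝ (region d) =
      {((-1 + 2 / d : ℝ), (0 : ℝ)), ((1 : ℝ), (0 : ℝ))} ∪
        (fun x : ℝ => (x, d * maxTrace d x ^ 2)) '' Set.Icc (-1 + 2 / d : ℝ) 1 := by
  have hlo : (-1 + 2 / d : ℝ) ≤ 1 := by
    have hd' : (2 : ℝ) ≤ d := by exact_mod_cast hd
    have : (2 : ℝ) / d ≤ 1 := by rw [div_le_one] <;> linarith
    linarith
  have hg := curve_pos (d := d) (by omega)
  refine Set.Subset.antisymm ?_ ?_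
  · rintro ⟨x, y⟩ ⟨⟨hx, hy1, hy2⟩, hext⟩
    simp only at hx hy1 hy2
    by_cases hyg : y = d * maxTrace d x ^ 2
    · exact Or.inr ⟨x, hx, by rw [hyg]⟩
    have hyg' := lt_of_le_of_ne hy2 hyg
    left
    have hy0 : y = 0 := by
      by_contra hy0
      have hpos := lt_of_le_of_ne hy1 (Ne.symm hy0)
      have hseg : (x, y) ∈ openSegment ℝ (x, (0 : ℝ)) (x, d * maxTrace d x ^ 2) := by
        rw [← Prod.image_mk_openSegment_right, openSegment_eq_Ioo (hg x)]
        exact ⟨y, ⟨hpos, hyg'⟩, rfl⟩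
      have := hext ⟨hx, le_rfl, (hg x).le⟩ ⟨hx, (hg x).le, le_rfl⟩ hseg
      exact hy0 (Prod.ext_iff.1 this).2.symm
    subst hy0
    by_contra hne
    simp only [Set.mem_insert_iff, Set.mem_singleton_iff, not_or, Prod.mk.injEq, and_true] at hne
    have h1 := lt_of_le_of_ne hx.1 (Ne.symm hne.1)
    have h2 := lt_of_le_of_ne hx.2 hne.2
    have hseg : (x, (0 : ℝ)) ∈ openSegment ℝ ((-1 + 2 / d : ℝ), (0 : ℝ)) ((1 : ℝ), (0 : ℝ)) := by
      rw [← Prod.image_mk_openSegment_left, openSegment_eq_Ioo (h1.trans h2)]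
      exact ⟨x, ⟨h1, h2⟩, rfl⟩
    have := hext ⟨⟨le_rfl, hlo⟩, le_rfl, (hg _).le⟩ ⟨⟨hlo, le_rfl⟩, le_rfl, (hg _).le⟩ hseg
    exact hne.1 (Prod.ext_iff.1 this).1.symm
  · rintro z (hz | ⟨x, hx, rfl⟩)
    · have hz2 : z.2 = 0 := by rcases hz with rfl | rfl <;> rfl
      have hz1 : z.1 = -1 + 2 / d ∨ z.1 = 1 := by
        rcases hz with rfl | rfl
        · exact Or.inl rfl
        · exact Or.inr rfl
      refine ⟨⟨?_, hz2.ge, hz2.le.trans (hg _).le⟩, ?_⟩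
      · rcases hz1 with h | h <;> rw [h]
        · exact ⟨le_rfl, hlo⟩
        · exact ⟨hlo, le_rfl⟩
      rintro p ⟨hp, hp1, -⟩ q ⟨hq, hq1, -⟩ ⟨a, b, ha, hb, hab, rfl⟩
      simp only [Prod.fst_add, Prod.snd_add, Prod.smul_fst, Prod.smul_snd, smul_eq_mul] at hz1 hz2 ⊢
      have hb' : b = 1 - a := by linarith
      -- Both heights are nonnegative with a vanishing positive combination; the first coordinates
      -- are then pinned in the same way at an end of the interval.
      have hp2 : p.2 = 0 := by nlinarith
      have hq2 : q.2 = 0 := by nlinarith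
      have hpq : p.1 = a * p.1 + b * q.1 := by
        rcases hz1 with h | h
        · have : p.1 ≤ -1 + 2 / d := by
            by_contra hcon
            push Not at hcon
            nlinarith [mul_pos ha (sub_pos.2 hcon), mul_nonneg hb.le (sub_nonneg.2 hq.1)]
          linarith [hp.1]
        · have : 1 ≤ p.1 := by
            by_contra hcon
            push Not at hcon
            nlinarith [mul_pos ha (sub_pos.2 hcon), mul_nonneg hb.le (sub_nonneg.2 hq.2)]
          linarith [hp.2]
      ext
      · simpa using hpq
      · simp [hp2, hq2]
    · refine ⟨⟨hx, (hg x).le, le_rfl⟩, ?_⟩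
      rintro p ⟨hp, hp1, hp2⟩ q ⟨hq, hq1, hq2⟩ ⟨a, b, ha, hb, hab, hz⟩
      have hz1 : a * p.1 + b * q.1 = x := congrArg Prod.fst hz
      have hz2 : a * p.2 + b * q.2 = d * maxTrace d x ^ 2 := congrArg Prod.snd hz
      have hle : a * p.2 + b * q.2 ≤ a * (d * maxTrace d p.1 ^ 2) + b * (d * maxTrace d q.1 ^ 2) :=
        add_le_add (mul_le_mul_of_nonneg_left hp2 ha.le) (mul_le_mul_of_nonneg_left hq2 hb.le)
      -- Different abscissas would put the combination strictly below the curve. With equal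
      -- abscissas both points lie under the same top point, so neither can be lower.
      have hpq : p.1 = q.1 := by
        by_contra hne
        have := (strictConcaveOn_curve hd).2 hp hq hne ha hb hab
        simp only [smul_eq_mul] at this
        rw [hz1] at this
        linarith
      have hb' : b = 1 - a := by linarith
      have hpx : p.1 = x := by rw [← hz1, ← hpq, ← add_mul, hab, one_mul]
      rw [← hpq, hpx] at hq2
      rw [hpx] at hp2
      ext
      · exact hpx
      · refine le_antisymm hp2 ?_
        by_contra hcon
        push Not at hcon
        nlinarith [mul_pos ha (sub_pos.2 hcon), mul_nonneg hb.le (sub_nonneg.2 hq2)]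

/-! ### Compactness and covariant representatives -/

/-- In a finite-dimensional real topological vector space the convex hull of a compact set is
compact. -/
lemma isCompact_convexHull_of_isCompact {E : Type*} [AddCommGroup E] [Module ℝ E]
    [TopologicalSpace E] [ContinuousAdd E] [ContinuousSMul ℝ E] [FiniteDimensional ℝ E]
    {K : Set E} (hK : IsCompact K) : IsCompact (convexHull ℝ K) := by
  -- By Carathéodory, finrank + 1 points suffice, so the hull is the continuous image of a simplex
  -- times a power of K.
  set n := Module.finrank ℝ E + 1 with hn
  have himage : convexHull ℝ K = (fun p : (Fin n → ℝ) × (Fin n → E) => ∑ i, p.1 i • p.2 i) ''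
      (stdSimplex ℝ (Fin n) ×ˢ Set.univ.pi fun _ => K) := by
    refine Set.Subset.antisymm ?_ ?_
    · intro x hx
      obtain ⟨ι, _, z, w, hz, hind, hw, hsum, rfl⟩ := eq_pos_convex_span_of_mem_convexHull hx
      have hcard : Fintype.card ι ≤ Fintype.card (Fin n) := by
        rw [Fintype.card_fin, hn]
        exact hind.card_le_finrank_succ.trans (by gcongr; exact Submodule.finrank_le _)
      obtain ⟨e⟩ := Function.Embedding.nonempty_of_card_le hcard
      have hne : Nonempty ι := by
        by_contra h
        rw [not_nonempty_iff] at h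
        simp at hsum
      obtain ⟨i₀⟩ := hne
      have hw0 : ∀ j, j ∉ Finset.univ.map e → Function.extend e w 0 j = 0 := by
        intro j hj
        rw [Function.extend_apply' _ _ _ (by simpa using hj)]
        rfl
      -- Unused slots get weight 0, but their point must still lie in K, hence the filler z i₀.
      refine ⟨(Function.extend e w 0, Function.extend e z fun _ => z i₀),
        ⟨⟨fun j => ?_, ?_⟩, fun j _ => ?_⟩, ?_⟩
      · by_cases hj : ∃ i, e i = j
        · obtain ⟨i, rfl⟩ := hj
          simp only [e.injective.extend_apply]
          exact (hw i).le
        · simp only [Function.extend_apply' _ _ _ hj]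
          exact le_rfl
      · rw [← Finset.sum_subset (Finset.subset_univ (Finset.univ.map e))
          (fun j _ hj => hw0 j hj), Finset.sum_map]
        simpa only [e.injective.extend_apply] using hsum
      · by_cases hj : ∃ i, e i = j
        · obtain ⟨i, rfl⟩ := hj
          simp only [e.injective.extend_apply]
          exact hz ⟨i, rfl⟩
        · simp only [Function.extend_apply' _ _ _ hj]
          exact hz ⟨i₀, rfl⟩
      · simp only
        rw [← Finset.sum_subset (Finset.subset_univ (Finset.univ.map e))
          (fun j _ hj => by rw [hw0 j hj, zero_smul]), Finset.sum_map]
        simp only [e.injective.extend_apply]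
    · rintro _ ⟨⟨w, z⟩, ⟨hw, hz⟩, rfl⟩
      exact (convex_convexHull ℝ K).sum_mem (fun i _ => hw.1 i) hw.2
        fun i _ => subset_convexHull ℝ _ (hz i (Set.mem_univ i))
  rw [himage]
  refine ((isCompact_stdSimplex ℝ (Fin n)).prod (isCompact_univ_pi fun _ => hK)).image ?_
  fun_prop

lemma isCompact_unitaryGroup (n : Type*) [Fintype n] [DecidableEq n] :
    IsCompact (Matrix.unitaryGroup n ℂ : Set (Matrix n n ℂ)) := by
  have hbox : IsCompact (Set.univ.pi fun _ : n => Set.univ.pi fun _ : n =>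
      Metric.closedBall (0 : ℂ) 1) :=
    isCompact_univ_pi fun _ => isCompact_univ_pi fun _ => isCompact_closedBall _ _
  refine IsCompact.of_isClosed_subset (X := Matrix n n ℂ) hbox ?_ ?_
  · have : (Matrix.unitaryGroup n ℂ : Set (Matrix n n ℂ)) = {A | A * star A = 1} :=
      Set.ext fun A => Matrix.mem_unitaryGroup_iff
    rw [this]
    exact isClosed_eq (by fun_prop) continuous_const
  · intro A hA i _ j _
    rw [mem_closedBall_zero_iff]
    exact entry_norm_bound_of_unitary hA i j

/-- The squared Frobenius norm. -/
noncomputable def frobeniusSq {n : Type*} [Fintype n] (X : Matrix n n ℂ) : ℝ :=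
  ∑ i, ∑ j, Complex.normSq (X i j)

lemma continuous_frobeniusSq {n : Type*} [Fintype n] :
    Continuous (frobeniusSq : Matrix n n ℂ → ℝ) := by
  refine continuous_finsetSum _ fun i _ => continuous_finsetSum _ fun j _ =>
    Complex.continuous_normSq.comp ?_
  fun_prop

lemma frobeniusSq_eq_trace {n : Type*} [Fintype n] (X : Matrix n n ℂ) :
    (frobeniusSq X : ℂ) = (X * Xᴴ).trace := by
  simp only [frobeniusSq, Matrix.trace, Matrix.diag_apply, Matrix.mul_apply,
    Matrix.conjTranspose_apply, Complex.ofReal_sum]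
  exact Finset.sum_congr rfl fun i _ => Finset.sum_congr rfl fun j _ => by
    rw [← Complex.mul_conj]; rfl

lemma frobeniusSq_conj {n : Type*} [Fintype n] [DecidableEq n] {K : Matrix n n ℂ}
    (hK : Kᴴ * K = 1) (X : Matrix n n ℂ) : frobeniusSq (K * X * Kᴴ) = frobeniusSq X := by
  have : (frobeniusSq (K * X * Kᴴ) : ℂ) = frobeniusSq X := by
    rw [frobeniusSq_eq_trace, frobeniusSq_eq_trace, Matrix.conjTranspose_mul,
      Matrix.conjTranspose_mul, Matrix.conjTranspose_conjTranspose]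
    calc (K * X * Kᴴ * (K * (Xᴴ * Kᴴ))).trace = (K * (X * ((Kᴴ * K) * (Xᴴ * Kᴴ)))).trace := by
          simp only [Matrix.mul_assoc]
      _ = (X * Xᴴ).trace := by
          rw [hK, Matrix.one_mul, Matrix.trace_mul_comm, ← Matrix.mul_assoc, Matrix.mul_assoc,
            hK, Matrix.mul_one]
  exact_mod_cast this

/-- On a compact convex set of matrices the Frobenius norm has a unique minimizer. -/
lemma exists_unique_frobeniusSq_minimizer {n : Type*} [Fintype n] {K : Set (Matrix n n ℂ)}
    (hK : IsCompact K) (hconv : Convex ℝ K) (hne : K.Nonempty) :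
    ∃ X ∈ K, ∀ Y ∈ K, frobeniusSq Y = frobeniusSq X → Y = X := by
  obtain ⟨X, hX, hmin⟩ := hK.exists_isMinOn hne continuous_frobeniusSq.continuousOn
  refine ⟨X, hX, fun Y hY hYX => ?_⟩
  have hmid := hconv hX hY (by norm_num : (0 : ℝ) ≤ 1 / 2) (by norm_num : (0 : ℝ) ≤ 1 / 2)
    (by norm_num)
  have hle : frobeniusSq X ≤ frobeniusSq ((1 / 2 : ℝ) • X + (1 / 2 : ℝ) • Y) := hmin hmid
  -- Parallelogram identity: at equal norms the midpoint is smaller by ‖Y - X‖²/4, which minimality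
  -- forces to vanish.
  have hpar : frobeniusSq ((1 / 2 : ℝ) • X + (1 / 2 : ℝ) • Y) =
      (frobeniusSq X + frobeniusSq Y) / 2 - frobeniusSq (Y - X) / 4 := by
    simp only [frobeniusSq, ← Finset.sum_add_distrib, Finset.sum_div, ← Finset.sum_sub_distrib]
    refine Finset.sum_congr rfl fun i _ => Finset.sum_congr rfl fun j _ => ?_
    simp only [Matrix.add_apply, Matrix.smul_apply, Matrix.sub_apply, Complex.normSq_apply,
      Complex.add_re, Complex.add_im, Complex.sub_re, Complex.sub_im, Complex.real_smul,
      Complex.re_ofReal_mul, Complex.im_ofReal_mul]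
    ring
  have hzero : frobeniusSq (Y - X) ≤ 0 := by linarith
  have hnn : ∀ i, 0 ≤ ∑ j, Complex.normSq ((Y - X) i j) := fun i =>
    Finset.sum_nonneg fun j _ => Complex.normSq_nonneg _
  have h0 := (Finset.sum_eq_zero_iff_of_nonneg fun i _ => hnn i).1
    (le_antisymm hzero (Finset.sum_nonneg fun i _ => hnn i))
  ext i j
  have := (Finset.sum_eq_zero_iff_of_nonneg fun j _ => Complex.normSq_nonneg _).1
    (h0 i (Finset.mem_univ i)) j (Finset.mem_univ j)
  rw [Complex.normSq_eq_zero, Matrix.sub_apply, sub_eq_zero] at this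
  exact this

/-- A real orthogonal matrix as a complex unitary. -/
noncomputable def complexify {d : ℕ} (O : Matrix (Fin d) (Fin d) ℝ)
    (hO : O ∈ Matrix.orthogonalGroup (Fin d) ℝ) : Matrix.unitaryGroup (Fin d) ℂ :=
  ⟨O.map Complex.ofReal, by
    rw [Matrix.mem_unitaryGroup_iff]
    have h : O * Oᵀ = 1 := (Matrix.mem_orthogonalGroup_iff _ _).1 hO
    have h2 : star (O.map Complex.ofReal) = (Oᵀ).map Complex.ofReal := by
      ext i j
      simp [Matrix.star_apply]
    rw [h2]
    have := congrArg (fun A => Matrix.map A Complex.ofReal) h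
    refine (Matrix.map_mul (L := O) (M := Oᵀ) (f := Complex.ofRealHom)).symm.trans (this.trans ?_)
    exact Matrix.map_one _ Complex.ofReal_zero Complex.ofReal_one⟩

lemma complexify_conjTranspose {d : ℕ} (O : Matrix (Fin d) (Fin d) ℝ)
    (hO : O ∈ Matrix.orthogonalGroup (Fin d) ℝ) :
    (complexify O hO : Mat d)ᴴ = (O.map Complex.ofReal)ᵀ := by
  ext i j
  simp [complexify]

lemma complexify_map_star {d : ℕ} (O : Matrix (Fin d) (Fin d) ℝ)
    (hO : O ∈ Matrix.orthogonalGroup (Fin d) ℝ) :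
    (complexify O hO : Mat d).map star = complexify O hO := by
  ext i j
  simp [complexify]

/-- The map `ρ ↦ V† T(V ρ V†) V`, as a function of `T`. -/
noncomputable def conjChannel {d : ℕ} (V : Matrix.unitaryGroup (Fin d) ℂ) :
    (Mat d →ₗ[ℂ] Mat d) →ₗ[ℝ] (Mat d →ₗ[ℂ] Mat d) where
  toFun T := unitaryChannel V⁻¹ ∘ₗ T ∘ₗ unitaryChannel V
  map_add' T S := by
    ext1 ρ
    simp
  map_smul' c T := by
    ext1 ρ
    simp [LinearMap.map_smul_of_tower]

lemma conjChannel_unitaryChannel {d : ℕ} (V U : Matrix.unitaryGroup (Fin d) ℂ) :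
    conjChannel V (unitaryChannel U) = unitaryChannel (V⁻¹ * U * V) := by
  refine LinearMap.ext fun ρ => ?_
  change unitaryChannel V⁻¹ (unitaryChannel U (unitaryChannel V ρ)) = _
  simp only [unitaryChannel_apply, Matrix.UnitaryGroup.mul_val, Matrix.conjTranspose_mul,
    Matrix.mul_assoc]

/-- Two real-linear maps agree on a subspace, so agreement at the unitary channels spreads to their
hull. -/
lemma unitaryMixture_ext {d : ℕ} {E : Type*} [AddCommGroup E] [Module ℝ E]
    {f g : (Mat d →ₗ[ℂ] Mat d) →ₗ[ℝ] E}
    (h : ∀ U : Matrix.unitaryGroup (Fin d) ℂ, f (unitaryChannel U) = g (unitaryChannel U))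
    {T : Mat d →ₗ[ℂ] Mat d} (hT : IsUnitaryMixture T) : f T = g T := by
  have : unitaryMixtures d ⊆ (LinearMap.eqLocus f g : Set (Mat d →ₗ[ℂ] Mat d)) := by
    rw [unitaryMixtures_eq_convexHull]
    refine convexHull_min ?_ (Submodule.convex ((LinearMap.eqLocus f g)))
    rintro _ ⟨U, rfl⟩
    exact h U
  exact this hT

lemma isUnitaryMixture_conjChannel {d : ℕ} (V : Matrix.unitaryGroup (Fin d) ℂ)
    {T : Mat d →ₗ[ℂ] Mat d} (hT : IsUnitaryMixture T) : IsUnitaryMixture (conjChannel V T) := by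
  have : conjChannel V '' unitaryMixtures d ⊆ unitaryMixtures d := by
    rw [unitaryMixtures_eq_convexHull, (conjChannel V).image_convexHull, ← Set.range_comp]
    refine convexHull_mono ?_
    rintro _ ⟨U, rfl⟩
    exact ⟨_, (conjChannel_unitaryChannel V U).symm⟩
  exact this ⟨T, hT, rfl⟩

/-- For real V, conjugating U to V†UV conjugates Ū and U Ū in the same way, so both traces survive.
-/
lemma coords_conjChannel {d : ℕ} {V : Matrix.unitaryGroup (Fin d) ℂ}
    (hV : (V : Mat d).map star = V) {T : Mat d →ₗ[ℂ] Mat d} (hT : IsUnitaryMixture T) :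
    coords (conjChannel V T) = coords T := by
  refine unitaryMixture_ext (f := coordsLin d ∘ₗ conjChannel V) (g := coordsLin d)
    (fun U => ?_) hT
  rw [LinearMap.comp_apply, conjChannel_unitaryChannel, coordsLin_apply, coordsLin_apply,
    coords_unitaryChannel, coords_unitaryChannel]
  have h1 : (V : Mat d) * star (V : Mat d) = 1 := Matrix.mem_unitaryGroup_iff.1 V.2
  have hs : (star (V : Mat d)).map star = star (V : Mat d) := by
    conv_rhs => rw [← hV]
    rfl
  have hstar : ∀ A B : Mat d, (A * B).map star = A.map star * B.map star :=
    fun A B => Matrix.map_mul (f := starRingEnd ℂ)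
  have ht : ∀ A : Mat d, (star (V : Mat d) * A * V).trace = A.trace := by
    intro A
    rw [Matrix.trace_mul_comm, ← Matrix.mul_assoc, h1, Matrix.one_mul]
  simp only [Matrix.UnitaryGroup.mul_val, Matrix.UnitaryGroup.inv_val, hstar, hs, hV, ht]
  have : star (V : Mat d) * (U : Mat d) * V * (star (V : Mat d) * (U : Mat d).map star * V) =
      star (V : Mat d) * ((U : Mat d) * (U : Mat d).map star) * V := by
    calc _ = star (V : Mat d) * (U : Mat d) * (((V : Mat d) * star (V : Mat d)) *
        ((U : Mat d).map star * V)) := by simp only [Matrix.mul_assoc]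
      _ = _ := by rw [h1, Matrix.one_mul]; simp only [Matrix.mul_assoc]
  rw [this, ht]

open scoped Kronecker in
-- A unitary channel has operator (1/d)|U⟩⟩⟨⟨U|, and vectorizing V†UV applies Vᵀ ⊗ V† to |U⟩⟩.
-- Linearity extends this to mixtures.
lemma jamiolkowski_conjChannel {d : ℕ} {V : Matrix.unitaryGroup (Fin d) ℂ}
    {T : Mat d →ₗ[ℂ] Mat d} (hT : IsUnitaryMixture T) :
    jamiolkowski (conjChannel V T) =
      ((V : Mat d)ᵀ ⊗ₖ (V : Mat d)ᴴ) * jamiolkowski T * ((V : Mat d)ᵀ ⊗ₖ (V : Mat d)ᴴ)ᴴ := by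
  refine unitaryMixture_ext (f := jamiolkowskiLin d ∘ₗ conjChannel V)
    (g := LinearMap.mulRight ℝ (((V : Mat d)ᵀ ⊗ₖ (V : Mat d)ᴴ)ᴴ) ∘ₗ
      LinearMap.mulLeft ℝ ((V : Mat d)ᵀ ⊗ₖ (V : Mat d)ᴴ) ∘ₗ jamiolkowskiLin d) (fun U => ?_) hT
  set K := (V : Mat d)ᵀ ⊗ₖ (V : Mat d)ᴴ with hK
  have hvec : ∀ W : Matrix.unitaryGroup (Fin d) ℂ, jamiolkowski (unitaryChannel W) =
      (1 / d : ℂ) • vecMulVec (fun p => (W : Mat d) p.2 p.1)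
        (star fun p => (W : Mat d) p.2 p.1) := by
    intro W
    ext p q
    rw [jamiolkowski_apply, unitaryChannel_single]
    rfl
  have hKv : (fun p : Fin d × Fin d => ((V⁻¹ * U * V : Matrix.unitaryGroup (Fin d) ℂ) : Mat d)
      p.2 p.1) = K *ᵥ fun p => (U : Mat d) p.2 p.1 := by
    funext p
    simp only [Matrix.UnitaryGroup.mul_val, Matrix.UnitaryGroup.inv_val, Matrix.mulVec, dotProduct,
      Fintype.sum_prod_type, hK, Matrix.kroneckerMap_apply, Matrix.mul_apply, Matrix.star_apply,
      Matrix.transpose_apply, Matrix.conjTranspose_apply, Finset.sum_mul]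
    exact Finset.sum_congr rfl fun i _ => Finset.sum_congr rfl fun j _ => by ring
  change jamiolkowski (conjChannel V (unitaryChannel U)) =
    K * jamiolkowski (unitaryChannel U) * Kᴴ
  rw [conjChannel_unitaryChannel, hvec, hvec, hKv, Matrix.mul_smul, Matrix.smul_mul,
    Matrix.mul_vecMulVec, Matrix.vecMulVec_mul, Matrix.star_mulVec]

open scoped Kronecker in
lemma frobeniusSq_jamiolkowski_conjChannel {d : ℕ} {V : Matrix.unitaryGroup (Fin d) ℂ}
    {T : Mat d →ₗ[ℂ] Mat d} (hT : IsUnitaryMixture T) :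
    frobeniusSq (jamiolkowski (conjChannel V T)) = frobeniusSq (jamiolkowski T) := by
  rw [jamiolkowski_conjChannel hT]
  refine frobeniusSq_conj ?_ _
  have h1 : (V : Mat d)ᵀ ∈ Matrix.unitaryGroup (Fin d) ℂ :=
    Matrix.transpose_mem_unitaryGroup_iff.2 V.2
  have h2 : (V : Mat d)ᴴ ∈ Matrix.unitaryGroup (Fin d) ℂ := (V⁻¹).2
  exact Matrix.mem_unitaryGroup_iff'.1 (Matrix.kronecker_mem_unitary h1 h2)

lemma isOrthogonalCovariant_of_conjChannel_eq {d : ℕ} {T : Mat d →ₗ[ℂ] Mat d}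
    (h : ∀ O hO, conjChannel (complexify O hO) T = T) : IsOrthogonalCovariant T := by
  intro O hO ρ
  have hV : (complexify O hO : Mat d) * (complexify O hO : Mat d)ᴴ = 1 :=
    Matrix.mem_unitaryGroup_iff.1 (complexify O hO).2
  have e : (complexify O hO : Mat d) = O.map Complex.ofReal := rfl
  conv_rhs => rw [← h O hO]
  rw [← complexify_conjTranspose O hO, ← e]
  set V := complexify O hO
  change _ = (V : Mat d) * ((V : Mat d)ᴴ * T ((V : Mat d) * ρ * (V : Mat d)ᴴ) *
    (V : Mat d)ᴴᴴ) * (V : Mat d)ᴴ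
  rw [Matrix.conjTranspose_conjTranspose]
  set Y := T ((V : Mat d) * ρ * (V : Mat d)ᴴ)
  calc Y = ((V : Mat d) * (V : Mat d)ᴴ) * Y * ((V : Mat d) * (V : Mat d)ᴴ) := by
        rw [hV, Matrix.one_mul, Matrix.mul_one]
    _ = _ := by simp only [Matrix.mul_assoc]

lemma isCompact_jamiolkowski_image (d : ℕ) :
    IsCompact (jamiolkowskiLin d '' unitaryMixtures d) := by
  rw [unitaryMixtures_eq_convexHull, (jamiolkowskiLin d).image_convexHull, ← Set.range_comp]
  refine isCompact_convexHull_of_isCompact ?_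
  have : Set.range (jamiolkowskiLin d ∘ unitaryChannel) =
      (fun U : Mat d => (Matrix.of fun p q => 1 / (d : ℂ) * (U p.2 p.1 * star (U q.2 q.1)) :
        BiMat d)) '' (Matrix.unitaryGroup (Fin d) ℂ : Set (Mat d)) := by
    rw [Set.image_eq_range]
    congr 1
    funext U
    ext p q
    change jamiolkowski _ _ _ = _
    rw [jamiolkowski_apply, unitaryChannel_single]
    rfl
  rw [this]
  refine (isCompact_unitaryGroup (Fin d)).image ?_
  refine continuous_matrix fun p q => ?_
  simp only [Matrix.of_apply]
  fun_prop

/-- A norm minimizer replaces averaging over the orthogonal group: the fibre over given coordinates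
is compact, convex and stable under norm-preserving conjugations, so its unique minimizer is a fixed
point. -/
lemma coords_image_covariantUnitaryMixtures {d : ℕ} (hd : d ≠ 0) :
    coords '' covariantUnitaryMixtures d = coords '' unitaryMixtures d := by
  refine Set.Subset.antisymm (Set.image_mono fun T hT => hT.1) ?_
  rintro _ ⟨T₀, hT₀, rfl⟩
  set K := jamiolkowskiLin d '' unitaryMixtures d ∩ flipTraces d ⁻¹' {coords T₀} with hK
  have hcont : Continuous (flipTraces d) := by
    change Continuous fun X => ((X * flip d).trace.re, (X * flipHat d).trace.re)
    fun_prop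
  have hcompact : IsCompact K :=
    (isCompact_jamiolkowski_image d).inter_right (isClosed_singleton.preimage hcont)
  have hconvex : Convex ℝ K := by
    refine Convex.inter ?_ ((convex_singleton _).linear_preimage _)
    rw [unitaryMixtures_eq_convexHull]
    exact (convex_convexHull ℝ _).linear_image _
  obtain ⟨_, ⟨⟨T, hT, rfl⟩, hTc⟩, huniq⟩ :=
    exists_unique_frobeniusSq_minimizer hcompact hconvex ⟨_, ⟨T₀, hT₀, rfl⟩, rfl⟩
  refine ⟨T, ⟨hT, isOrthogonalCovariant_of_conjChannel_eq fun O hO => ?_⟩, hTc⟩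
  refine jamiolkowskiLin_injective hd (huniq _ ⟨⟨_, isUnitaryMixture_conjChannel _ hT, rfl⟩, ?_⟩
    (frobeniusSq_jamiolkowski_conjChannel hT))
  exact (coords_conjChannel (complexify_map_star O hO) hT).trans hTc

/-! ### Covariant maps have three parameters -/

lemma involutionMatrix_conj_apply {n R : Type*} [Fintype n] [DecidableEq n] [CommRing R]
    (σ : n → n) (a b : n → R) (X : Matrix n n R) (i j : n) :
    (involutionMatrix σ a b * X * (involutionMatrix σ a b)ᵀ) i j =
      a i * a j * X i j + a i * b j * X i (σ j) + b i * a j * X (σ i) j +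
        b i * b j * X (σ i) (σ j) := by
  have h1 : ∀ Y : Matrix n n R, ∀ i j, (involutionMatrix σ a b * Y) i j =
      a i * Y i j + b i * Y (σ i) j := by
    intro Y i j
    simp [Matrix.mul_apply, involutionMatrix_apply, add_mul, Finset.sum_add_distrib]
  have h2 : ∀ Y : Matrix n n R, ∀ i j, (Y * (involutionMatrix σ a b)ᵀ) i j =
      a j * Y i j + b j * Y i (σ j) := by
    intro Y i j
    rw [← Matrix.transpose_apply (Y * _), Matrix.transpose_mul, Matrix.transpose_transpose, h1]
    rfl
  rw [h2, h1, h1]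
  ring

lemma IsOrthogonalCovariant.involution {d : ℕ} {T : Mat d →ₗ[ℂ] Mat d}
    (hT : IsOrthogonalCovariant T) {σ : Fin d → Fin d} (hσ : Function.Involutive σ)
    {a b : Fin d → ℝ} (h1 : ∀ i, a i * a i + b i * b i = 1)
    (h2 : ∀ i, a i * b (σ i) + b i * a (σ i) = 0) (ρ : Mat d) :
    T (involutionMatrix σ (fun i => (a i : ℂ)) (fun i => (b i : ℂ)) * ρ *
        (involutionMatrix σ (fun i => (a i : ℂ)) (fun i => (b i : ℂ)))ᵀ) =
      involutionMatrix σ (fun i => (a i : ℂ)) (fun i => (b i : ℂ)) * T ρ *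
        (involutionMatrix σ (fun i => (a i : ℂ)) (fun i => (b i : ℂ)))ᵀ := by
  have hO : involutionMatrix σ a b ∈ Matrix.orthogonalGroup (Fin d) ℝ := by
    rw [Matrix.mem_orthogonalGroup_iff]
    exact involutionMatrix_mul_conjTranspose hσ (by simpa using h1) (by simpa using h2)
  have hmap : (involutionMatrix σ a b).map Complex.ofReal =
      involutionMatrix σ (fun i => (a i : ℂ)) (fun i => (b i : ℂ)) := by
    ext i j
    simp [involutionMatrix_apply, apply_ite Complex.ofReal]
  rw [← hmap]
  exact hT _ hO ρ

/-- Covariance under the reflection of the k-th axis. It kills each coefficient in which some index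
occurs an odd number of times. -/
lemma IsOrthogonalCovariant.sign_flip {d : ℕ} {T : Mat d →ₗ[ℂ] Mat d}
    (hT : IsOrthogonalCovariant T) (k i j a b : Fin d) :
    (if i = k then -1 else 1) * (if j = k then -1 else 1) * T (Matrix.single i j 1) a b =
      (if a = k then -1 else 1) * (if b = k then -1 else 1) * T (Matrix.single i j 1) a b := by
  have h := hT.involution (σ := id) (fun _ => rfl) (a := fun i => if i = k then -1 else 1)
    (b := fun _ => 0) (fun i => by split_ifs <;> norm_num) (fun i => by simp)
    (Matrix.single i j 1)
  have e : involutionMatrix id (fun i => ((if i = k then -1 else 1 : ℝ) : ℂ))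
      (fun _ => ((0 : ℝ) : ℂ)) * Matrix.single i j 1 *
      (involutionMatrix id (fun i => ((if i = k then -1 else 1 : ℝ) : ℂ))
        (fun _ => ((0 : ℝ) : ℂ)))ᵀ =
      ((if i = k then -1 else 1) * (if j = k then -1 else 1) : ℂ) •
        Matrix.single i j (1 : ℂ) := by
    ext u v
    rw [involutionMatrix_conj_apply]
    by_cases hu : i = u
    · by_cases hv : j = v
      · subst hu hv
        simp [apply_ite Complex.ofReal]
      · simp [hv]
    · simp [hu]
  rw [e, map_smul] at h
  have h' := congrFun (congrFun h a) b
  rw [involutionMatrix_conj_apply, Matrix.smul_apply, smul_eq_mul] at h'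
  rw [h']
  simp [apply_ite Complex.ofReal]

lemma IsOrthogonalCovariant.perm {d : ℕ} {T : Mat d →ₗ[ℂ] Mat d}
    (hT : IsOrthogonalCovariant T) (π : Equiv.Perm (Fin d)) (i j a b : Fin d) :
    T (Matrix.single (π i) (π j) 1) (π a) (π b) = T (Matrix.single i j 1) a b := by
  set O : Matrix (Fin d) (Fin d) ℝ := Matrix.of fun i j => if π.symm i = j then 1 else 0 with hOdef
  have hO : O ∈ Matrix.orthogonalGroup (Fin d) ℝ := by
    rw [Matrix.mem_orthogonalGroup_iff]
    ext u v
    simp [hOdef, Matrix.mul_apply, Matrix.one_apply, eq_comm]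
  have hconj : ∀ (X : Mat d) (u v : Fin d),
      (O.map Complex.ofReal * X * (O.map Complex.ofReal)ᵀ) u v = X (π.symm u) (π.symm v) := by
    intro X u v
    simp [hOdef, Matrix.mul_apply, apply_ite Complex.ofReal]
  have h := hT O hO (Matrix.single i j 1)
  have e : O.map Complex.ofReal * Matrix.single i j 1 * (O.map Complex.ofReal)ᵀ =
      Matrix.single (π i) (π j) 1 := by
    ext u v
    rw [hconj]
    simp [Matrix.single_apply, Equiv.eq_symm_apply]
  rw [e] at h
  rw [h, hconj, Equiv.symm_apply_apply, Equiv.symm_apply_apply]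

lemma exists_perm_pair {d : ℕ} {p q i j : Fin d} (hpq : p ≠ q) (hij : i ≠ j) :
    ∃ π : Equiv.Perm (Fin d), π p = i ∧ π q = j :=
  MulAction.is_two_pretransitive_iff.1
    (Equiv.Perm.isMultiplyPretransitive (Fin d) 2) hpq hij

/-- Signs and permutations cannot relate the coefficient with four equal indices to the others. The
Hadamard reflection in the p-q plane does: it sends the unit at (p, p) to half the all-ones block,
and the (p, q) entries are compared. -/
lemma IsOrthogonalCovariant.diag_eq {d : ℕ} {T : Mat d →ₗ[ℂ] Mat d}
    (hT : IsOrthogonalCovariant T) {p q : Fin d} (hpq : p ≠ q) :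
    T (Matrix.single p p 1) p p = T (Matrix.single p p 1) q q + T (Matrix.single p q 1) p q +
      T (Matrix.single p q 1) q p := by
  set r : ℝ := (Real.sqrt 2)⁻¹ with hr
  have hrr : r * r = 1 / 2 := by
    rw [hr, ← mul_inv, Real.mul_self_sqrt (by norm_num)]
    norm_num
  have hrC : (r : ℂ) * r = 1 / 2 := inv_sqrt_two_mul_self
  set A : Fin d → ℝ := fun i => if i = p then r else if i = q then -r else 1 with hA
  set B : Fin d → ℝ := fun i => if i = p then r else if i = q then r else 0 with hB
  have h := hT.involution (σ := Equiv.swap p q) (Equiv.swap_apply_self p q) (a := A) (b := B)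
    (fun i => by
      simp only [hA, hB]
      split_ifs
      · linear_combination 2 * hrr
      · linear_combination 2 * hrr
      · ring)
    (fun i => by
      by_cases hp : i = p
      · simp [hA, hB, hp, hpq.symm]
      · by_cases hq : i = q
        · simp [hA, hB, hq, hpq.symm]
        · simp [hA, hB, hp, hq, Equiv.swap_apply_of_ne_of_ne hp hq])
    (Matrix.single p p 1)
  have hAp : A p = r := by simp [hA]
  have hAq : A q = -r := by simp [hA, hpq.symm]
  have hBp : B p = r := by simp [hB]
  have hBq : B q = r := by simp [hB, hpq.symm]
  have e : involutionMatrix (Equiv.swap p q) (fun i => (A i : ℂ)) (fun i => (B i : ℂ)) *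
      Matrix.single p p 1 *
      (involutionMatrix (Equiv.swap p q) (fun i => (A i : ℂ)) (fun i => (B i : ℂ)))ᵀ =
      (1 / 2 : ℂ) • (Matrix.single p p (1 : ℂ) + Matrix.single p q 1 + Matrix.single q p 1 +
        Matrix.single q q 1) := by
    have hw : ∀ u, (A u : ℂ) * (if p = u then 1 else 0) +
        B u * (if p = Equiv.swap p q u then 1 else 0) =
        r * ((if p = u then 1 else 0) + if q = u then 1 else 0) := by
      intro u
      by_cases hp : p = u
      · subst hp
        simp [hAp, hpq, hpq.symm]
      · by_cases hq : q = u
        · subst hq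
          simp [hBq, hp]
        · simp [hp, hq, Equiv.swap_apply_of_ne_of_ne (Ne.symm hp) (Ne.symm hq)]
    have hs : ∀ i j u v : Fin d, Matrix.single i j (1 : ℂ) u v =
        (if i = u then 1 else 0) * (if j = v then 1 else 0) := by
      intro i j u v
      by_cases h : i = u <;> simp [Matrix.single_apply, h]
    ext u v
    rw [involutionMatrix_conj_apply]
    simp only [Matrix.smul_apply, Matrix.add_apply, smul_eq_mul, hs]
    have hprod := congrArg₂ (· * ·) (hw u) (hw v)
    linear_combination hprod + ((if p = u then 1 else 0) + if q = u then 1 else 0 : ℂ) *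
      ((if p = v then 1 else 0) + if q = v then 1 else 0) * hrC
  rw [e, map_smul] at h
  have h' := congrFun (congrFun h p) q
  rw [involutionMatrix_conj_apply] at h'
  simp only [map_add, Matrix.smul_apply, Matrix.add_apply, smul_eq_mul, hAp, hAq, hBp, hBq,
    Equiv.swap_apply_left, Equiv.swap_apply_right, Complex.ofReal_neg] at h'
  have s1 := hT.sign_flip p p p p q
  have s2 := hT.sign_flip p q q p q
  have s3 := hT.sign_flip p p p q p
  have s4 := hT.perm (Equiv.swap p q) p q q p
  simp only [Equiv.swap_apply_left, Equiv.swap_apply_right] at s4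
  simp only [hpq.symm, if_true, if_false] at s1 s2 s3
  have z1 : T (Matrix.single p p 1) p q = 0 := by linear_combination s1 / 2
  have z2 : T (Matrix.single q q 1) p q = 0 := by linear_combination s2 / 2
  have z3 : T (Matrix.single p p 1) q p = 0 := by linear_combination s3 / 2
  rw [z1, z2, z3, s4] at h'
  linear_combination (-2 : ℂ) * h' - 2 * (T (Matrix.single p p 1) p p -
    T (Matrix.single p p 1) q q) * hrC

/-- The three terms are tr(·)1, the identity and the transpose. Sign flips remove unpaired indices,
two-transitivity of permutations makes each pairing type constant, and `diag_eq` settles four equal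
indices. -/
lemma IsOrthogonalCovariant.apply_single {d : ℕ} {T : Mat d →ₗ[ℂ] Mat d}
    (hT : IsOrthogonalCovariant T) {p q : Fin d} (hpq : p ≠ q) (i j a b : Fin d) :
    T (Matrix.single i j 1) a b =
      (if i = j ∧ a = b then T (Matrix.single p p 1) q q else 0) +
      (if i = a ∧ j = b then T (Matrix.single p q 1) p q else 0) +
      (if i = b ∧ j = a then T (Matrix.single p q 1) q p else 0) := by
  have off : ∀ i a : Fin d, i ≠ a →
      T (Matrix.single i i 1) a a = T (Matrix.single p p 1) q q ∧
      T (Matrix.single i a 1) i a = T (Matrix.single p q 1) p q ∧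
      T (Matrix.single i a 1) a i = T (Matrix.single p q 1) q p := by
    intro i a hia
    obtain ⟨π, rfl, rfl⟩ := exists_perm_pair hpq hia
    exact ⟨hT.perm π _ _ _ _, hT.perm π _ _ _ _, hT.perm π _ _ _ _⟩
  by_cases hij : i = j
  · subst hij
    by_cases hab : a = b
    · subst hab
      by_cases hia : i = a
      · subst hia
        have hex : ∃ m, i ≠ m := by
          by_cases h : i = p
          · exact ⟨q, by rw [h]; exact hpq⟩
          · exact ⟨p, h⟩
        obtain ⟨m, hm⟩ := hex
        obtain ⟨e1, e2, e3⟩ := off i m hm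
        rw [hT.diag_eq hm, e1, e2, e3]
        simp
      · simp [hia, (off i a hia).1]
    · have s := hT.sign_flip a i i a b
      have hba : ¬ b = a := fun h => hab h.symm
      have hz : T (Matrix.single i i 1) a b = 0 := by
        simp only [if_true, hba, if_false] at s
        split_ifs at s <;> linear_combination s / 2
      rw [hz]
      have h1 : ¬ (i = a ∧ i = b) := fun h => hab (h.1.symm.trans h.2)
      have h2 : ¬ (i = b ∧ i = a) := fun h => hab (h.2.symm.trans h.1)
      simp [hab, h1, h2]
  · have hji : ¬ j = i := fun h => hij h.symm
    by_cases h1 : i = a ∧ j = b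
    · obtain ⟨rfl, rfl⟩ := h1
      simp [hij, (off i j hij).2.1]
    by_cases h2 : i = b ∧ j = a
    · obtain ⟨rfl, rfl⟩ := h2
      simp [hij, hji, (off i j hij).2.2]
    -- Since i ≠ j and (a, b) is neither (i, j) nor (j, i), flipping axis i or axis j changes
    -- exactly one side's sign.
    have hz : T (Matrix.single i j 1) a b = 0 := by
      have s1 := hT.sign_flip i i j a b
      have s2 := hT.sign_flip j i j a b
      simp only [if_true, hij, hji, if_false] at s1 s2
      by_cases ha : a = i
      · have hb : ¬ b = j := fun h => h1 ⟨ha.symm, h.symm⟩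
        have ha' : ¬ a = j := fun h => hij (ha.symm.trans h)
        simp only [ha', hb, if_false] at s2
        linear_combination -s2 / 2
      · by_cases hb : b = i
        · have haj : ¬ a = j := fun h => h2 ⟨hb.symm, h.symm⟩
          have hbj : ¬ b = j := fun h => hij (hb.symm.trans h)
          simp only [haj, hbj, if_false] at s2
          linear_combination -s2 / 2
        · simp only [ha, hb, if_false] at s1
          linear_combination -s1 / 2
    rw [hz]
    simp [hij, h1, h2]

lemma IsUnitaryMixture.star_apply_single {d : ℕ} {T : Mat d →ₗ[ℂ] Mat d}
    (hT : IsUnitaryMixture T) (i j a b : Fin d) :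
    star (T (Matrix.single i j 1) a b) = T (Matrix.single j i 1) b a := by
  obtain ⟨N, p, U, -, -, h⟩ := hT
  simp only [h, Matrix.sum_apply, Matrix.smul_apply, unitaryChannel_single, star_sum, smul_eq_mul,
    star_mul', Complex.star_def, Complex.conj_ofReal, Complex.conj_conj]
  exact Finset.sum_congr rfl fun i _ => by ring

lemma IsUnitaryMixture.trace_apply {d : ℕ} {T : Mat d →ₗ[ℂ] Mat d}
    (hT : IsUnitaryMixture T) (ρ : Mat d) : (T ρ).trace = ρ.trace := by
  obtain ⟨N, p, U, -, hsum, h⟩ := hT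
  have hU : ∀ i, (unitaryChannel (U i) ρ).trace = ρ.trace := by
    intro i
    have : (U i : Mat d)ᴴ * (U i : Mat d) = 1 := Matrix.mem_unitaryGroup_iff'.1 (U i).2
    rw [unitaryChannel_apply, Matrix.trace_mul_comm, ← Matrix.mul_assoc, this, Matrix.one_mul]
  have hsum' : ∑ i, (p i : ℂ) = 1 := by exact_mod_cast congrArg Complex.ofReal hsum
  rw [h, Matrix.trace_sum]
  simp only [Matrix.trace_smul, hU, smul_eq_mul]
  rw [← Finset.sum_mul, hsum', one_mul]

/-- The parameters of a covariant mixture are real and satisfy three linear equations. -/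
lemma covariantUnitaryMixture_parameters {d : ℕ} {T : Mat d →ₗ[ℂ] Mat d}
    (hT : IsUnitaryMixture T) (hcov : IsOrthogonalCovariant T) {p q : Fin d} (hpq : p ≠ q) :
    ∃ α β γ : ℝ, (∀ i j a b, T (Matrix.single i j 1) a b =
      (if i = j ∧ a = b then (α : ℂ) else 0) + (if i = a ∧ j = b then (β : ℂ) else 0) +
        (if i = b ∧ j = a then (γ : ℂ) else 0)) ∧
      d * α + β + γ = 1 ∧ coords T = (α + β + d * γ, α + d * β + γ) := by
  have hform := hcov.apply_single hpq
  have hd : (d : ℝ) ≠ 0 := by exact_mod_cast (Fin.pos p).ne'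
  have hdC : (d : ℂ) ≠ 0 := by exact_mod_cast hd
  have hreal : ∀ z : ℂ, star z = z → ∃ x : ℝ, z = x := fun z hz =>
    ⟨z.re, (Complex.conj_eq_iff_re.1 hz).symm⟩
  obtain ⟨α, hα⟩ := hreal (T (Matrix.single p p 1) q q) (hT.star_apply_single _ _ _ _)
  obtain ⟨β, hβ⟩ := hreal (T (Matrix.single p q 1) p q) (by
    rw [hT.star_apply_single, hform q p q p]
    simp [hpq, hpq.symm])
  obtain ⟨γ, hγ⟩ := hreal (T (Matrix.single p q 1) q p) (by
    rw [hT.star_apply_single, hform q p p q]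
    simp [hpq, hpq.symm])
  rw [hα, hβ, hγ] at hform
  refine ⟨α, β, γ, hform, ?_, ?_⟩
  · have htr := hT.trace_apply (Matrix.single p p 1)
    rw [Matrix.trace_single_eq_same, Matrix.trace] at htr
    simp only [Matrix.diag_apply, hform, and_self, if_true, Finset.sum_add_distrib,
      Finset.sum_const, Finset.card_univ, Fintype.card_fin, nsmul_eq_mul, Finset.sum_ite_eq,
      Finset.mem_univ] at htr
    exact_mod_cast htr
  · rw [coords_eq_sum]
    have e1 : ∑ i, ∑ a, T (Matrix.single i a 1) a i =
        (d : ℂ) * ((α + β + d * γ : ℝ) : ℂ) := by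
      have : ∀ i a : Fin d, T (Matrix.single i a 1) a i =
          (if i = a then (α : ℂ) else 0) + (if i = a then (β : ℂ) else 0) + γ := by
        intro i a
        rw [hform]
        by_cases h : i = a <;> simp [h, eq_comm]
      simp only [this, Finset.sum_add_distrib, Finset.sum_ite_eq, Finset.mem_univ, if_true,
        Finset.sum_const, Finset.card_univ, Fintype.card_fin, nsmul_eq_mul]
      push_cast
      ring
    have e2 : ∑ i, ∑ j, T (Matrix.single i j 1) i j =
        (d : ℂ) * ((α + d * β + γ : ℝ) : ℂ) := by
      have : ∀ i j : Fin d, T (Matrix.single i j 1) i j =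
          (if i = j then (α : ℂ) else 0) + β + (if i = j then (γ : ℂ) else 0) := by
        intro i j
        rw [hform]
        by_cases h : i = j <;> simp [h, eq_comm]
      simp only [this, Finset.sum_add_distrib, Finset.sum_ite_eq, Finset.mem_univ, if_true,
        Finset.sum_const, Finset.card_univ, Fintype.card_fin, nsmul_eq_mul]
      push_cast
      ring
    rw [e1, e2, ← mul_assoc, ← mul_assoc, one_div_mul_cancel hdC, one_mul, one_mul,
      Complex.ofReal_re, Complex.ofReal_re]

lemma linearMap_ext_single {d : ℕ} {T S : Mat d →ₗ[ℂ] Mat d}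
    (h : ∀ i j a b, T (Matrix.single i j 1) a b = S (Matrix.single i j 1) a b) : T = S := by
  rcases eq_or_ne d 0 with rfl | hd
  · exact LinearMap.ext fun ρ => Subsingleton.elim _ _
  refine jamiolkowskiLin_injective hd (Matrix.ext fun p q => ?_)
  change jamiolkowski T p q = jamiolkowski S p q
  rw [jamiolkowski_apply, jamiolkowski_apply, h]

lemma coords_injOn_covariantUnitaryMixtures {d : ℕ} (hd : 2 ≤ d) :
    Set.InjOn (coords (d := d)) (covariantUnitaryMixtures d) := by
  rintro T ⟨hT, hTc⟩ S ⟨hS, hSc⟩ hTS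
  have hpq : (⟨0, by omega⟩ : Fin d) ≠ ⟨1, by omega⟩ := by simp
  obtain ⟨α, β, γ, h1, h2, h3⟩ := covariantUnitaryMixture_parameters hT hTc hpq
  obtain ⟨α', β', γ', h1', h2', h3'⟩ := covariantUnitaryMixture_parameters hS hSc hpq
  rw [h3, h3', Prod.mk.injEq] at hTS
  obtain ⟨hx, hy⟩ := hTS
  have hdR : (2 : ℝ) ≤ d := by exact_mod_cast hd
  have hd1 : (d : ℝ) - 1 ≠ 0 := by linarith
  have hd2 : (d : ℝ) + 2 ≠ 0 := by linarith
  -- Adding the three equations gives (d + 2)(α + β + γ); subtracting this sum from each one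
  -- isolates (d - 1) times a single parameter.
  have hsum : α + β + γ = α' + β' + γ' :=
    mul_left_cancel₀ hd2 (by linear_combination h2 - h2' + hx + hy)
  have hα : α = α' := mul_left_cancel₀ hd1 (by linear_combination h2 - h2' - hsum)
  have hγ : γ = γ' := mul_left_cancel₀ hd1 (by linear_combination hx - hsum)
  have hβ : β = β' := mul_left_cancel₀ hd1 (by linear_combination hy - hsum)
  refine linearMap_ext_single fun i j a b => ?_
  rw [h1, h1', hα, hβ, hγ]

/-! ### Werner–Holevo type maps -/

lemma coords_wernerHolevo_fst {d : ℕ} (hd : d ≠ 0) (δ : ℝ) :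
    (coords (wernerHolevo d δ)).1 = (1 + δ) / d - d * δ := by
  have hdC : (d : ℂ) ≠ 0 := by exact_mod_cast hd
  rw [coords_eq_sum]
  have e : ∀ i a : Fin d, wernerHolevo d δ (Matrix.single i a 1) a i =
      (if i = a then (((1 + δ) / d : ℝ) : ℂ) else 0) - δ := by
    intro i a
    change ((((1 + δ) / d : ℝ) : ℂ) • ((Matrix.single i a (1 : ℂ)).trace • (1 : Mat d)) -
      (δ : ℂ) • (Matrix.single i a (1 : ℂ))ᵀ) a i = _
    by_cases h : i = a
    · subst h
      simp
    · simp [h]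
  have e1 : 1 / (d : ℂ) * ∑ i, ∑ a, wernerHolevo d δ (Matrix.single i a 1) a i =
      (((1 + δ) / d - d * δ : ℝ) : ℂ) := by
    simp only [e, Finset.sum_sub_distrib, Finset.sum_ite_eq, Finset.mem_univ, if_true,
        Finset.sum_const, Finset.card_univ, Fintype.card_fin, nsmul_eq_mul]
    push_cast
    field_simp
  rw [e1, Complex.ofReal_re]

lemma coords_wernerHolevo_lt_iff {d : ℕ} (hd : 2 ≤ d) (δ : ℝ) :
    (coords (wernerHolevo d δ)).1 < -1 + 2 / d ↔ 1 / (d + 1) < δ := by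
  have hdR : (2 : ℝ) ≤ d := by exact_mod_cast hd
  have hpos : (0 : ℝ) < (d - 1) * (d + 1) / d := by
    apply div_pos (mul_pos _ _) <;> linarith
  have e : (-1 + 2 / d) - ((1 + δ) / d - d * δ) =
      (d - 1) * (d + 1) / d * (δ - 1 / ((d : ℝ) + 1)) := by
    field_simp
    ring
  rw [coords_wernerHolevo_fst (by omega), ← sub_pos, e, mul_pos_iff_of_pos_left hpos, sub_pos]

end Birkhoff

theorem mainTheorem2 (d : ℕ) (hd : 3 ≤ d) (hodd : Odd d) :
    -- the two numbers are genuine coordinates on the covariant mixtures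
    Set.InjOn (Birkhoff.coords (d := d)) (Birkhoff.covariantUnitaryMixtures d) ∧
    -- the region: covariant mixtures, all mixtures, hull of the unitary channels
    Birkhoff.coords '' Birkhoff.covariantUnitaryMixtures d =
      Birkhoff.coords '' Birkhoff.unitaryMixtures d ∧
    Birkhoff.coords '' Birkhoff.unitaryMixtures d =
      convexHull ℝ (Set.range fun U : Matrix.unitaryGroup (Fin d) ℂ =>
        Birkhoff.coords (Birkhoff.unitaryChannel U)) ∧
    -- its extreme points
    Set.extremePoints ℝ (Birkhoff.coords '' Birkhoff.covariantUnitaryMixtures d) =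
      {((-1 + 2 / d : ℝ), (0 : ℝ)), ((1 : ℝ), (0 : ℝ))} ∪
        (fun x : ℝ => (x, d * Birkhoff.maxTrace d x ^ 2)) '' Set.Icc (-1 + 2 / d : ℝ) 1 ∧
    -- maps with small flip expectation, in particular those of Werner-Holevo type
    (∀ T : Birkhoff.Mat d →ₗ[ℂ] Birkhoff.Mat d,
      (Birkhoff.coords T).1 < -1 + 2 / d → ¬ Birkhoff.IsUnitaryMixture T) ∧
    (∀ δ : ℝ, (Birkhoff.coords (Birkhoff.wernerHolevo d δ)).1 < -1 + 2 / d ↔ 1 / (d + 1) < δ) ∧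
    (∀ δ : ℝ, 1 / (d + 1) < δ → ¬ Birkhoff.IsUnitaryMixture (Birkhoff.wernerHolevo d δ)) := by
  have himage := Birkhoff.coords_image_covariantUnitaryMixtures (d := d) (by omega)
  have hhull := Birkhoff.coords_image_unitaryMixtures d
  have hregion := Birkhoff.convexHull_coords_eq_region hd hodd
  have hsmall : ∀ T : Birkhoff.Mat d →ₗ[ℂ] Birkhoff.Mat d,
      (Birkhoff.coords T).1 < -1 + 2 / d → ¬ Birkhoff.IsUnitaryMixture T := by
    intro T hlt hT
    have hmem : Birkhoff.coords T ∈ Birkhoff.region d := by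
      rw [← hregion, ← hhull]
      exact ⟨T, hT, rfl⟩
    exact absurd hmem.1.1 (not_le.2 hlt)
  have hiff := Birkhoff.coords_wernerHolevo_lt_iff (d := d) (by omega)
  refine ⟨Birkhoff.coords_injOn_covariantUnitaryMixtures (by omega), himage, hhull, ?_, hsmall,
    hiff, fun δ hδ => hsmall _ ((hiff δ).2 hδ)⟩
  rw [himage, hhull, hregion]
  exact Birkhoff.extremePoints_region (by omega)
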